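/- **Notation.** Let $N\ge 1$ and $\Gamma=\Gamma(N)\subset SL_2(\mathbb Z)$ the principal congruence subgroup. Let $\mathcal M=\bigoplus_{m\ge 0}\mathcal M_m$ be the modular tower, where $\mathcal M_m$ is the union over all $N'\ge 1$ of the spaces of (holomorphic) modular forms of weight $m$ for $\Gamma(N')$. A holomorphic $f:\mathbb H\to\mathbb C$ is quasimodular of level $N'$, weight $k\ge 0$ and depth $s\ge 0$ if there are functions $f_0,\dots,f_s$, with $f_s\neq 0$, holomorphic on $\mathbb H$ and at the cusps (i.e. $(cz+d)^{-(k-2j)}f_j(\gamma z)$ is bounded as $\operatorname{Im} z\to\infty$ for every $\gamma=\begin{pmatrix}a&b\\c&d\end{pmatrix}\in SL_2(\mathbb Z)$), such that $(cz+d)^{-k}f(\gamma z)=\sum_{j=0}^s f_j(z)\left(\frac{c}{cz+d}\right)^j$ for all $\gamma=\begin{pmatrix}a&b\\c&d\end{pmatrix}\in\Gamma(N')$; the zero function is quasimodular of every level and weight, of depth $0$. Let $\mathcal{QM}$ be the space of finite sums of quasimodular forms of arbitrary levels, weights and depths. With $G_2(z)=-\frac1{24}+\sum_{n\ge1}\sigma_1(n)e^{2\pi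 i nz}$, every $f\in\mathcal{QM}$ is uniquely a polynomial $f=\sum_i a_i(f)G_2^i$ with $a_i(f)\in\mathcal M$. For $\alpha=\begin{pmatrix}a&b\\c&d\end{pmatrix}\in GL_2^+(\mathbb Q)$ and $g$ of weight $m$ put $(g|\alpha)(z)=\det(\alpha)^{m/2}(cz+d)^{-m}g\left(\frac{az+b}{cz+d}\right)$, extended linearly to $\mathcal M$, and for $f\in\mathcal{QM}$ put $f\|\alpha=\sum_i(a_i(f)|\alpha)\,G_2^i$. Let $\Delta(z)=(2\pi)^{12}q\prod_{n\ge1}(1-q^n)^{24}$, $q=e^{2\pi iz}$. For $g\in\mathcal M_m$ put $$Y(g)=\tfrac m2\,g,\qquad X(g)=\frac1{2\pi i}g'-\frac1{12\pi i}\frac{\Delta'}{\Delta}\,Y(g),$$ extend $X$ and $Y$ linearly to $\mathcal M$ and then to $\mathcal{QM}$ by $X(f)=\sum_iX(a_i(f))G_2^i$, $Y(f)=\sum_iY(a_i(f))G_2^i$, and put $\mu_\alpha=\frac1{12\pi i}\frac{d}{dz}\log\frac{\Delta|\alpha}{\Delta}$. Let $\mathcal Q(\Gamma)$ be the complex vector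 space of functions $F:\Gamma\backslash GL_2^+(\mathbb Q)\to\mathcal{QM}$, $\Gamma\alpha\mapsto F_\alpha$, of finite support with $F_{\alpha\gamma}=F_\alpha\|\gamma$ for all $\gamma\in\Gamma$. It carries the associative products $$(F\ast G)_\alpha=\sum_{\beta\in\Gamma\backslash GL_2^+(\mathbb Q)}F_\beta\cdot(G_{\alpha\beta^{-1}}\|\beta),\qquad (F\ast^rG)_\alpha=\sum_{\beta\in\Gamma\backslash SL_2(\mathbb Z)}F_\beta\cdot(G_{\alpha\beta^{-1}}\|\beta),$$ of which $\ast$ has a unit element. Let $\mathcal H_1$ be the Hopf algebra that, as an algebra, is the universal enveloping algebra of the complex Lie algebra with generators $X,Y,\delta_n$ ($n\ge1$) and relations $[Y,X]=X$, $[X,\delta_n]=\delta_{n+1}$, $[Y,\delta_n]=n\delta_n$, $[\delta_k,\delta_l]=0$, with coproduct determined by $\Delta(X)=X\otimes1+1\otimes X+\delta_1\otimes Y$, $\Delta(Y)=Y\otimes1+1\otimes Y$, $\Delta(\delta_1)=\delta_1\otimes1+1\otimes\delta_1$, counit $\varepsilon$ vanishing on $X,Y,\delta_1$, and antipode $S(X)=-X+\delta_1Y$,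 $S(Y)=-Y$, $S(\delta_1)=-\delta_1$. Let $\mathfrak h_1$ be the universal enveloping algebra, with its usual Hopf algebra structure, of the complex Lie algebra with generators $X,Y$ and the relation $[Y,X]=X$. **Theorem.** Let $N\ge1$ and $\Gamma=\Gamma(N)$. (a) The formulas $$X(F)_\alpha=X(F_\alpha),\qquad Y(F)_\alpha=Y(F_\alpha),\qquad \delta_n(F)_\alpha=X^{n-1}(\mu_\alpha)\cdot F_\alpha\quad(n\ge1)$$ make $\mathcal Q(\Gamma)$ an $\mathcal H_1$-module, and this is a Hopf action on the algebra $(\mathcal Q(\Gamma),\ast)$: for all $h\in\mathcal H_1$ and $F^1,F^2\in\mathcal Q(\Gamma)$, $$h(F^1\ast F^2)=\sum h_{(1)}(F^1)\ast h_{(2)}(F^2),\qquad \Delta(h)=\sum h_{(1)}\otimes h_{(2)},$$ and $h(1)=\varepsilon(h)\,1$ for the unit $1$ of $(\mathcal Q(\Gamma),\ast)$. (b) The formulas $X(F)_\alpha=X(F_\alpha)$, $Y(F)_\alpha=Y(F_\alpha)$ make $\mathcal Q(\Gamma)$ an $\mathfrak h_1$-module, and this is a Hopf action on $\mathcal Q^r(\Gamma)=(\mathcal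 Q(\Gamma),\ast^r)$: for all $h\in\mathfrak h_1$ and $F^1,F^2\in\mathcal Q(\Gamma)$, $h(F^1\ast^rF^2)=\sum h_{(1)}(F^1)\ast^rh_{(2)}(F^2)$. In particular $X$ and $Y$ act by derivations. -/

import Mathlib

open scoped TensorProduct DirectSum MatrixGroups Manifold ModularForm UpperHalfPlane

noncomputable section

namespace QMHecke

attribute [local instance 100] LieRing.ofAssociativeRing

/-! ### Lie algebras given by generators and relations -/

/-- The complex Lie algebra presented by the generators `G` and the relations `r = 0`, `r ∈ R`. -/
abbrev PresentedLie {G : Type} (R : Set (FreeLieAlgebra ℂ G)) : Type :=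
  FreeLieAlgebra ℂ G ⧸ LieSubmodule.lieSpan ℂ (FreeLieAlgebra ℂ G) R

/-- The class of a generator. -/
def PresentedLie.of {G : Type} (R : Set (FreeLieAlgebra ℂ G)) (g : G) : PresentedLie R :=
  LieSubmodule.Quotient.mk (FreeLieAlgebra.of ℂ g)

/-- The class of an element of the free Lie algebra. -/
def PresentedLie.mk {G : Type} (R : Set (FreeLieAlgebra ℂ G)) :
    FreeLieAlgebra ℂ G →ₗ⁅ℂ⁆ PresentedLie R :=
  { (LieSubmodule.lieSpan ℂ (FreeLieAlgebra ℂ G) R).toSubmodule.mkQ with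
    map_lie' := fun {x y} => LieSubmodule.Quotient.mk_bracket
      (I := LieSubmodule.lieSpan ℂ (FreeLieAlgebra ℂ G) R) x y }

theorem PresentedLie.mk_eq_zero {G : Type} {R : Set (FreeLieAlgebra ℂ G)}
    {r : FreeLieAlgebra ℂ G} (hr : r ∈ R) : PresentedLie.mk R r = 0 :=
  (Submodule.Quotient.mk_eq_zero (LieSubmodule.lieSpan ℂ (FreeLieAlgebra ℂ G) R).toSubmodule).2
    (LieSubmodule.subset_lieSpan hr)

/-- The universal property of a presentation. -/
def PresentedLie.lift {G : Type} (R : Set (FreeLieAlgebra ℂ G)) {L : Type} [LieRing L]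
    [LieAlgebra ℂ L] (f : G → L) (hf : ∀ r ∈ R, FreeLieAlgebra.lift ℂ f r = 0) :
    PresentedLie R →ₗ⁅ℂ⁆ L :=
  { (LieSubmodule.lieSpan ℂ (FreeLieAlgebra ℂ G) R).toSubmodule.liftQ
      (FreeLieAlgebra.lift ℂ f : FreeLieAlgebra ℂ G →ₗ[ℂ] L) (by
        have h : LieSubmodule.lieSpan ℂ (FreeLieAlgebra ℂ G) R
            ≤ (FreeLieAlgebra.lift ℂ f).ker :=
          LieSubmodule.lieSpan_le.2 (fun r hr => (LieHom.mem_ker).2 (hf r hr))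
        intro x hx
        exact (LieHom.mem_ker).1 (h hx)) with
    map_lie' := fun {x y} => by
      obtain ⟨a, rfl⟩ := Submodule.mkQ_surjective _ x
      obtain ⟨b, rfl⟩ := Submodule.mkQ_surjective _ y
      exact LieHom.map_lie (FreeLieAlgebra.lift ℂ f) a b }

theorem PresentedLie.lift_of {G : Type} (R : Set (FreeLieAlgebra ℂ G)) {L : Type} [LieRing L]
    [LieAlgebra ℂ L] (f : G → L) (hf : ∀ r ∈ R, FreeLieAlgebra.lift ℂ f r = 0) (g : G) :
    PresentedLie.lift R f hf (PresentedLie.of R g) = f g :=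
  FreeLieAlgebra.lift_of_apply f g

theorem PresentedLie.hom_ext {G : Type} {R : Set (FreeLieAlgebra ℂ G)} {L : Type} [LieRing L]
    [LieAlgebra ℂ L] {f g : PresentedLie R →ₗ⁅ℂ⁆ L}
    (h : ∀ x, f (PresentedLie.of R x) = g (PresentedLie.of R x)) : f = g := by
  have h1 : f.comp (PresentedLie.mk R) = g.comp (PresentedLie.mk R) :=
    FreeLieAlgebra.hom_ext h
  ext x
  obtain ⟨a, rfl⟩ := Submodule.mkQ_surjective _ x
  exact LieHom.congr_fun h1 a

/-- The universal enveloping algebra of a presented Lie algebra. -/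
abbrev PresentedU {G : Type} (R : Set (FreeLieAlgebra ℂ G)) : Type :=
  UniversalEnvelopingAlgebra ℂ (PresentedLie R)

/-- A generator of the Lie algebra as an element of the enveloping algebra. -/
def PresentedU.of {G : Type} (R : Set (FreeLieAlgebra ℂ G)) (g : G) : PresentedU R :=
  UniversalEnvelopingAlgebra.ι ℂ (PresentedLie.of R g)

/-- The algebra map from the enveloping algebra defined by the images of the generators. -/
def PresentedU.lift {G : Type} (R : Set (FreeLieAlgebra ℂ G)) {A : Type} [Ring A] [Algebra ℂ A]
    (f : G → A) (hf : ∀ r ∈ R, FreeLieAlgebra.lift ℂ f r = 0) : PresentedU R →ₐ[ℂ] A :=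
  UniversalEnvelopingAlgebra.lift ℂ (PresentedLie.lift R f hf)

theorem PresentedU.lift_of {G : Type} (R : Set (FreeLieAlgebra ℂ G)) {A : Type} [Ring A]
    [Algebra ℂ A] (f : G → A) (hf : ∀ r ∈ R, FreeLieAlgebra.lift ℂ f r = 0) (g : G) :
    PresentedU.lift R f hf (PresentedU.of R g) = f g := by
  unfold PresentedU.lift PresentedU.of
  rw [UniversalEnvelopingAlgebra.lift_ι_apply, PresentedLie.lift_of]

theorem PresentedU.hom_ext {G : Type} {R : Set (FreeLieAlgebra ℂ G)} {A : Type} [Ring A]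
    [Algebra ℂ A] {f g : PresentedU R →ₐ[ℂ] A}
    (h : ∀ x, f (PresentedU.of R x) = g (PresentedU.of R x)) : f = g := by
  apply UniversalEnvelopingAlgebra.hom_ext
  exact PresentedLie.hom_ext h

/-- The generators satisfy the relations in the enveloping algebra. -/
theorem PresentedU.rel {G : Type} {R : Set (FreeLieAlgebra ℂ G)} {r : FreeLieAlgebra ℂ G}
    (hr : r ∈ R) : FreeLieAlgebra.lift ℂ (PresentedU.of R) r = 0 := by
  have h : FreeLieAlgebra.lift ℂ (PresentedU.of R)
      = (UniversalEnvelopingAlgebra.ι ℂ).comp (PresentedLie.mk R) := by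
    apply FreeLieAlgebra.hom_ext
    intro x
    rw [FreeLieAlgebra.lift_of_apply]
    rfl
  rw [h, LieHom.comp_apply, PresentedLie.mk_eq_zero hr, map_zero]

/-- A bialgebra whose underlying algebra is generated by elements satisfying the antipode
identities for an algebra map `S : H → Hᵐᵒᵖ` is a Hopf algebra: the set of elements satisfying
the antipode identities is a subalgebra. -/
theorem antipode_aux {H : Type} [Ring H] [Bialgebra ℂ H] (S : H →ₐ[ℂ] Hᵐᵒᵖ) (s : Set H)
    (hs : Algebra.adjoin ℂ s = ⊤) (T : H →ₗ[ℂ] H) (hT : ∀ a, T a = (S a).unop)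
    (h : ∀ a ∈ s, LinearMap.mul' ℂ H (T.rTensor H (Coalgebra.comul a))
        = algebraMap ℂ H (Coalgebra.counit a) ∧
      LinearMap.mul' ℂ H (T.lTensor H (Coalgebra.comul a))
        = algebraMap ℂ H (Coalgebra.counit a)) (a : H) :
    LinearMap.mul' ℂ H (T.rTensor H (Coalgebra.comul a))
        = algebraMap ℂ H (Coalgebra.counit a) ∧
      LinearMap.mul' ℂ H (T.lTensor H (Coalgebra.comul a))
        = algebraMap ℂ H (Coalgebra.counit a) := by
  have hTm : ∀ x y, T (x * y) = T y * T x := by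
    intro x y; simp [hT]
  have hT1 : T 1 = 1 := by simp [hT]
  have ha : a ∈ Algebra.adjoin ℂ s := hs ▸ Algebra.mem_top
  induction ha using Algebra.adjoin_induction with
  | mem x hx => exact h x hx
  | algebraMap r =>
    rw [Algebra.algebraMap_eq_smul_one]
    simp [Algebra.TensorProduct.one_def, hT1, Algebra.algebraMap_eq_smul_one]
  | add x y hx hy h1 h2 =>
    simp only [map_add, h1.1, h1.2, h2.1, h2.2, and_self]
  | mul x y hx hy h1 h2 =>
    have key1 : ∀ (u v : H ⊗[ℂ] H) (c : ℂ),
        LinearMap.mul' ℂ H (T.rTensor H u) = algebraMap ℂ H c →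
        LinearMap.mul' ℂ H (T.rTensor H (u * v))
          = algebraMap ℂ H c * LinearMap.mul' ℂ H (T.rTensor H v) := by
      intro u v c hu
      induction v using TensorProduct.induction_on with
      | zero => simp
      | add v w hv hw => simp only [mul_add, map_add, hv, hw]
      | tmul p q =>
        have : ∀ u : H ⊗[ℂ] H, LinearMap.mul' ℂ H (T.rTensor H (u * (p ⊗ₜ q)))
            = T p * LinearMap.mul' ℂ H (T.rTensor H u) * q := by
          intro u
          induction u using TensorProduct.induction_on with
          | zero => simp
          | add v w hv hw => simp only [add_mul, mul_add, map_add, hv, hw]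
          | tmul a b => simp [hTm, mul_assoc]
        rw [this, hu]
        simp only [LinearMap.rTensor_tmul, LinearMap.mul'_apply]
        rw [← Algebra.commutes, mul_assoc]
    have key2 : ∀ (u v : H ⊗[ℂ] H) (c : ℂ),
        LinearMap.mul' ℂ H (T.lTensor H v) = algebraMap ℂ H c →
        LinearMap.mul' ℂ H (T.lTensor H (u * v))
          = LinearMap.mul' ℂ H (T.lTensor H u) * algebraMap ℂ H c := by
      intro u v c hv
      induction u using TensorProduct.induction_on with
      | zero => simp
      | add v w hv hw => simp only [add_mul, map_add, hv, hw]
      | tmul p q =>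
        have : ∀ v : H ⊗[ℂ] H, LinearMap.mul' ℂ H (T.lTensor H ((p ⊗ₜ q) * v))
            = p * LinearMap.mul' ℂ H (T.lTensor H v) * T q := by
          intro u
          induction u using TensorProduct.induction_on with
          | zero => simp
          | add v w hv hw => simp only [add_mul, mul_add, map_add, hv, hw]
          | tmul a b => simp [hTm, mul_assoc]
        rw [this, hv]
        simp only [LinearMap.lTensor_tmul, LinearMap.mul'_apply]
        rw [mul_assoc, mul_assoc, Algebra.commutes]
    constructor
    · rw [Bialgebra.comul_mul, key1 _ _ _ h1.1, h2.1, Bialgebra.counit_mul, map_mul]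
    · rw [Bialgebra.comul_mul, key2 _ _ _ h2.2, h1.2, Bialgebra.counit_mul, map_mul]

/-! ### The Hopf algebra of codimension one foliations -/

/-- The generators `X`, `Y`, `δ_n` (`n ≥ 1`). -/
inductive Gen : Type
  | X : Gen
  | Y : Gen
  | δ : ℕ+ → Gen

/-- The relations `[Y, X] = X`, `[X, δ_n] = δ_{n+1}`, `[Y, δ_n] = n δ_n`, `[δ_k, δ_l] = 0`. -/
inductive relL1 : Set (FreeLieAlgebra ℂ Gen)
  | YX : relL1 (⁅FreeLieAlgebra.of ℂ Gen.Y, FreeLieAlgebra.of ℂ Gen.X⁆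
      - FreeLieAlgebra.of ℂ Gen.X)
  | Xδ (n : ℕ+) : relL1 (⁅FreeLieAlgebra.of ℂ Gen.X, FreeLieAlgebra.of ℂ (Gen.δ n)⁆
      - FreeLieAlgebra.of ℂ (Gen.δ (n + 1)))
  | Yδ (n : ℕ+) : relL1 (⁅FreeLieAlgebra.of ℂ Gen.Y, FreeLieAlgebra.of ℂ (Gen.δ n)⁆
      - (n : ℂ) • FreeLieAlgebra.of ℂ (Gen.δ n))
  | δδ (k l : ℕ+) : relL1 ⁅FreeLieAlgebra.of ℂ (Gen.δ k), FreeLieAlgebra.of ℂ (Gen.δ l)⁆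

/-- The algebra underlying the Connes–Moscovici Hopf algebra `ℋ₁`: the universal enveloping
algebra of the Lie algebra with generators `X`, `Y`, `δ_n`. Its coproduct (below) is not the
one of an enveloping algebra. -/
def H1 : Type := PresentedU relL1

instance : Ring H1 := inferInstanceAs (Ring (PresentedU relL1))
instance : Algebra ℂ H1 := inferInstanceAs (Algebra ℂ (PresentedU relL1))

namespace H1

/-- The element `X` of `ℋ₁`. -/
def X : H1 := PresentedU.of relL1 Gen.X
/-- The element `Y` of `ℋ₁`. -/
def Y : H1 := PresentedU.of relL1 Gen.Y
/-- The element `δ_n` of `ℋ₁`, `n ≥ 1`. -/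
def δ (n : ℕ+) : H1 := PresentedU.of relL1 (Gen.δ n)

theorem YX : Y * X - X * Y = X := by
  have h := PresentedU.rel relL1.YX
  simp only [map_sub, LieHom.map_lie, FreeLieAlgebra.lift_of_apply, sub_eq_zero] at h
  exact h

theorem Xδ (n : ℕ+) : X * δ n - δ n * X = δ (n + 1) := by
  have h := PresentedU.rel (relL1.Xδ n)
  simp only [map_sub, LieHom.map_lie, FreeLieAlgebra.lift_of_apply, sub_eq_zero] at h
  exact h

theorem Yδ (n : ℕ+) : Y * δ n - δ n * Y = (n : ℂ) • δ n := by
  have h := PresentedU.rel (relL1.Yδ n)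
  simp only [map_sub, LieHom.map_lie, map_smul, FreeLieAlgebra.lift_of_apply,
    sub_eq_zero] at h
  exact h

theorem δδ (k l : ℕ+) : Commute (δ k) (δ l) := by
  have h := PresentedU.rel (relL1.δδ k l)
  simp only [LieHom.map_lie, FreeLieAlgebra.lift_of_apply] at h
  exact sub_eq_zero.1 h

/-- Bracketing with `x` preserves the subalgebra generated by `s` if it does so on `s`. -/
theorem bracket_mem_adjoin {A : Type} [Ring A] [Algebra ℂ A] {s : Set A} {x : A}
    (h : ∀ a ∈ s, x * a - a * x ∈ Algebra.adjoin ℂ s) {b : A} (hb : b ∈ Algebra.adjoin ℂ s) :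
    x * b - b * x ∈ Algebra.adjoin ℂ s := by
  induction hb using Algebra.adjoin_induction with
  | mem a ha => exact h a ha
  | algebraMap r => rw [Algebra.commutes r x, sub_self]; exact zero_mem _
  | add a b ha hb h1 h2 =>
    have : x * (a + b) - (a + b) * x = (x * a - a * x) + (x * b - b * x) := by noncomm_ring
    rw [this]; exact add_mem h1 h2
  | mul a b ha hb h1 h2 =>
    have : x * (a * b) - (a * b) * x = (x * a - a * x) * b + a * (x * b - b * x) := by
      noncomm_ring
    rw [this]; exact add_mem (mul_mem h1 hb) (mul_mem ha h2)

/-- The elements `d`, `[x, d]`, `[x, [x, d]]`, …. -/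
def iter {A : Type} [Ring A] (x d : A) (n : ℕ+) : A := (fun a => x * a - a * x)^[(n : ℕ) - 1] d

theorem iter_one {A : Type} [Ring A] (x d : A) : iter x d 1 = d := rfl

theorem iter_succ {A : Type} [Ring A] (x d : A) (n : ℕ+) :
    iter x d (n + 1) = x * iter x d n - iter x d n * x := by
  have h : ((n + 1 : ℕ+) : ℕ) - 1 = ((n : ℕ) - 1) + 1 := by
    have := n.pos
    simp only [PNat.add_coe, PNat.one_coe]
    omega
  unfold iter
  rw [h, Function.iterate_succ_apply']

/-- The images of the generators determined by those of `X`, `Y`, `δ_1`. -/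
def genMap {A : Type} [Ring A] (x y d : A) : Gen → A
  | Gen.X => x
  | Gen.Y => y
  | Gen.δ n => iter x d n

theorem genMap_rel {A : Type} [Ring A] [Algebra ℂ A] (x y d : A) (s : Set A)
    (hyx : y * x - x * y = x) (hyd : y * d - d * y = d) (hd : d ∈ Algebra.adjoin ℂ s)
    (hs : ∀ a ∈ s, ∀ b ∈ s, Commute a b)
    (hx : ∀ a ∈ s, x * a - a * x ∈ Algebra.adjoin ℂ s) :
    ∀ r ∈ relL1, FreeLieAlgebra.lift ℂ (genMap x y d) r = 0 := by
  have hmem : ∀ n, iter x d n ∈ Algebra.adjoin ℂ s := by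
    intro n
    induction n using PNat.recOn with
    | one => exact hd
    | succ n ih => rw [iter_succ]; exact bracket_mem_adjoin hx ih
  have hcomm : ∀ a ∈ Algebra.adjoin ℂ s, ∀ b ∈ Algebra.adjoin ℂ s, Commute a b := by
    intro a ha b hb
    apply Algebra.commute_of_mem_adjoin_of_forall_mem_commute hb
    intro c hc
    apply Commute.symm
    apply Algebra.commute_of_mem_adjoin_of_forall_mem_commute ha
    intro e he
    exact hs c hc e he
  intro r hr
  cases hr with
  | YX =>
    simp only [map_sub, LieHom.map_lie, FreeLieAlgebra.lift_of_apply, sub_eq_zero]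
    exact hyx
  | Xδ n =>
    simp only [map_sub, LieHom.map_lie, FreeLieAlgebra.lift_of_apply, sub_eq_zero]
    exact (iter_succ x d n).symm
  | Yδ n =>
    simp only [map_sub, LieHom.map_lie, map_smul, FreeLieAlgebra.lift_of_apply,
      sub_eq_zero]
    change y * iter x d n - iter x d n * y = (n : ℂ) • iter x d n
    induction n using PNat.recOn with
    | one => rw [iter_one, hyd]; simp
    | succ n ih =>
      rw [iter_succ]
      have e1 : y * (x * iter x d n - iter x d n * x) - (x * iter x d n - iter x d n * x) * y
          = ((y * x - x * y) * iter x d n - iter x d n * (y * x - x * y))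
            + (x * (y * iter x d n - iter x d n * y)
              - (y * iter x d n - iter x d n * y) * x) := by noncomm_ring
      rw [e1, hyx, ih]
      push_cast
      rw [mul_smul_comm, smul_mul_assoc, ← smul_sub, add_smul, one_smul, add_comm]
  | δδ k l =>
    simp only [LieHom.map_lie, FreeLieAlgebra.lift_of_apply]
    exact sub_eq_zero.2 (hcomm _ (hmem k) _ (hmem l))

/-- The algebra map from `ℋ₁` with prescribed values on `X`, `Y`, `δ_1`. -/
def lift {A : Type} [Ring A] [Algebra ℂ A] (x y d : A)
    (h : ∀ r ∈ relL1, FreeLieAlgebra.lift ℂ (genMap x y d) r = 0) : H1 →ₐ[ℂ] A :=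
  PresentedU.lift relL1 (genMap x y d) h

section
variable {A : Type} [Ring A] [Algebra ℂ A] (x y d : A)
  (h : ∀ r ∈ relL1, FreeLieAlgebra.lift ℂ (genMap x y d) r = 0)

theorem lift_X : lift x y d h X = x := PresentedU.lift_of relL1 (genMap x y d) h Gen.X
theorem lift_Y : lift x y d h Y = y := PresentedU.lift_of relL1 (genMap x y d) h Gen.Y
theorem lift_δ : lift x y d h (δ 1) = d := PresentedU.lift_of relL1 (genMap x y d) h (Gen.δ 1)

end

theorem hom_ext {A : Type} [Ring A] [Algebra ℂ A] {f g : H1 →ₐ[ℂ] A} (hX : f X = g X)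
    (hY : f Y = g Y) (hδ : f (δ 1) = g (δ 1)) : f = g := by
  apply PresentedU.hom_ext (R := relL1)
  intro z
  cases z with
  | X => exact hX
  | Y => exact hY
  | δ n =>
    change f (δ n) = g (δ n)
    induction n using PNat.recOn with
    | one => exact hδ
    | succ n ih => rw [← Xδ]; simp only [map_sub, map_mul, hX, ih]

theorem adjoin_eq_top : Algebra.adjoin ℂ ({X, Y, δ 1} : Set H1) = ⊤ := by
  have mX : X ∈ Algebra.adjoin ℂ ({X, Y, δ 1} : Set H1) := Algebra.subset_adjoin (by simp)
  have mY : Y ∈ Algebra.adjoin ℂ ({X, Y, δ 1} : Set H1) := Algebra.subset_adjoin (by simp)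
  have mδ : ∀ n, δ n ∈ Algebra.adjoin ℂ ({X, Y, δ 1} : Set H1) := by
    intro n
    induction n using PNat.recOn with
    | one => exact Algebra.subset_adjoin (by simp)
    | succ n ih => rw [← Xδ]; exact sub_mem (mul_mem mX ih) (mul_mem ih mX)
  rw [eq_top_iff]
  rintro a -
  let W := Algebra.adjoin ℂ ({X, Y, δ 1} : Set H1)
  have hr := genMap_rel (A := W) ⟨X, mX⟩ ⟨Y, mY⟩ ⟨δ 1, mδ 1⟩ (Set.range fun n => ⟨δ n, mδ n⟩)
    (Subtype.ext YX) (Subtype.ext (by simpa using Yδ 1))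
    (Algebra.subset_adjoin ⟨1, rfl⟩)
    (by
      rintro _ ⟨k, rfl⟩ _ ⟨l, rfl⟩
      exact Subtype.ext (δδ k l))
    (by
      rintro _ ⟨k, rfl⟩
      exact Algebra.subset_adjoin ⟨k + 1, Subtype.ext (Xδ k).symm⟩)
  have he : W.val.comp (lift _ _ _ hr) = AlgHom.id ℂ H1 := by
    apply hom_ext
    · simp [lift_X]
    · simp [lift_Y]
    · simp [lift_δ]
  have := DFunLike.congr_fun he a
  rw [AlgHom.id_apply] at this
  rw [← this]
  exact (lift _ _ _ hr a).2

theorem comul_rel : ∀ r ∈ relL1, FreeLieAlgebra.lift ℂ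
    (genMap (X ⊗ₜ[ℂ] (1 : H1) + (1 : H1) ⊗ₜ[ℂ] X + δ 1 ⊗ₜ[ℂ] Y)
      (Y ⊗ₜ[ℂ] (1 : H1) + (1 : H1) ⊗ₜ[ℂ] Y)
      (δ 1 ⊗ₜ[ℂ] (1 : H1) + (1 : H1) ⊗ₜ[ℂ] δ 1)) r = 0 := by
  have hY1 : Y * δ 1 = δ 1 * Y + δ 1 := by
    have := Yδ 1
    simp only [PNat.one_coe, Nat.cast_one, one_smul] at this
    exact (sub_eq_iff_eq_add'.1 this)
  have hYX : Y * X = X * Y + X := sub_eq_iff_eq_add'.1 YX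
  apply genMap_rel _ _ _ ((Set.range fun n => δ n ⊗ₜ[ℂ] (1 : H1)) ∪
    (Set.range fun n => (1 : H1) ⊗ₜ[ℂ] δ n))
  · simp only [add_mul, mul_add, Algebra.TensorProduct.tmul_mul_tmul, one_mul, mul_one, hYX, hY1,
      TensorProduct.add_tmul, TensorProduct.tmul_add]
    abel
  · simp only [add_mul, mul_add, Algebra.TensorProduct.tmul_mul_tmul, one_mul, mul_one, hY1,
      TensorProduct.add_tmul, TensorProduct.tmul_add]
    abel
  · exact add_mem (Algebra.subset_adjoin (Or.inl ⟨1, rfl⟩))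
      (Algebra.subset_adjoin (Or.inr ⟨1, rfl⟩))
  · rintro _ (⟨k, rfl⟩ | ⟨k, rfl⟩) _ (⟨l, rfl⟩ | ⟨l, rfl⟩) <;>
      simp [commute_iff_eq, Algebra.TensorProduct.tmul_mul_tmul, (δδ k l).eq]
  · rintro _ (⟨k, rfl⟩ | ⟨k, rfl⟩)
    · have : (X ⊗ₜ[ℂ] (1 : H1) + (1 : H1) ⊗ₜ[ℂ] X + δ 1 ⊗ₜ[ℂ] Y) * (δ k ⊗ₜ[ℂ] (1 : H1))
          - (δ k ⊗ₜ[ℂ] (1 : H1)) * (X ⊗ₜ[ℂ] (1 : H1) + (1 : H1) ⊗ₜ[ℂ] X + δ 1 ⊗ₜ[ℂ] Y)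
          = δ (k + 1) ⊗ₜ[ℂ] (1 : H1) := by
        rw [← Xδ]
        simp only [add_mul, mul_add, Algebra.TensorProduct.tmul_mul_tmul, one_mul, mul_one,
          TensorProduct.sub_tmul, (δδ 1 k).eq]
        abel
      simp only [this]
      exact Algebra.subset_adjoin (Or.inl ⟨k + 1, rfl⟩)
    · have : (X ⊗ₜ[ℂ] (1 : H1) + (1 : H1) ⊗ₜ[ℂ] X + δ 1 ⊗ₜ[ℂ] Y) * ((1 : H1) ⊗ₜ[ℂ] δ k)
          - ((1 : H1) ⊗ₜ[ℂ] δ k) * (X ⊗ₜ[ℂ] (1 : H1) + (1 : H1) ⊗ₜ[ℂ] X + δ 1 ⊗ₜ[ℂ] Y)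
          = (1 : H1) ⊗ₜ[ℂ] δ (k + 1)
            + (k : ℂ) • ((δ 1 ⊗ₜ[ℂ] (1 : H1)) * ((1 : H1) ⊗ₜ[ℂ] δ k)) := by
        rw [Algebra.TensorProduct.tmul_mul_tmul, one_mul, mul_one, ← TensorProduct.tmul_smul,
          ← Xδ, ← Yδ]
        simp only [add_mul, mul_add, Algebra.TensorProduct.tmul_mul_tmul, one_mul, mul_one,
          TensorProduct.tmul_sub]
        abel
      simp only [this]
      refine add_mem (Algebra.subset_adjoin (Or.inr ⟨k + 1, rfl⟩)) (Subalgebra.smul_mem _ ?_ _)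
      exact mul_mem (Algebra.subset_adjoin (Or.inl ⟨1, rfl⟩))
        (Algebra.subset_adjoin (Or.inr ⟨k, rfl⟩))

/-- The coproduct of `ℋ₁`: the algebra map with `Δ X = X ⊗ 1 + 1 ⊗ X + δ_1 ⊗ Y`,
`Δ Y = Y ⊗ 1 + 1 ⊗ Y`, `Δ δ_1 = δ_1 ⊗ 1 + 1 ⊗ δ_1`. -/
def comulHom : H1 →ₐ[ℂ] H1 ⊗[ℂ] H1 :=
  lift (X ⊗ₜ[ℂ] (1 : H1) + (1 : H1) ⊗ₜ[ℂ] X + δ 1 ⊗ₜ[ℂ] Y)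
    (Y ⊗ₜ[ℂ] (1 : H1) + (1 : H1) ⊗ₜ[ℂ] Y)
    (δ 1 ⊗ₜ[ℂ] (1 : H1) + (1 : H1) ⊗ₜ[ℂ] δ 1) comul_rel

theorem counit_rel :
    ∀ r ∈ relL1, FreeLieAlgebra.lift ℂ (genMap (0 : ℂ) (0 : ℂ) (0 : ℂ)) r = 0 :=
  genMap_rel 0 0 0 ∅ (by simp) (by simp) (zero_mem _) (by simp) (by simp)

/-- The counit of `ℋ₁`, which vanishes on `X`, `Y`, `δ_1`. -/
def counitHom : H1 →ₐ[ℂ] ℂ := lift 0 0 0 counit_rel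

theorem antipode_rel : ∀ r ∈ relL1, FreeLieAlgebra.lift ℂ
    (genMap (MulOpposite.op (-X + δ 1 * Y)) (MulOpposite.op (-Y)) (MulOpposite.op (-δ 1))) r
      = 0 := by
  have hY1 : Y * δ 1 = δ 1 * Y + δ 1 := by
    have := Yδ 1
    simp only [PNat.one_coe, Nat.cast_one, one_smul] at this
    exact (sub_eq_iff_eq_add'.1 this)
  have hYX : Y * X = X * Y + X := sub_eq_iff_eq_add'.1 YX
  apply genMap_rel _ _ _ (Set.range fun n => MulOpposite.op (δ n))
  · rw [← MulOpposite.op_mul, ← MulOpposite.op_mul, ← MulOpposite.op_sub]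
    congr 1
    simp only [add_mul, mul_add, neg_mul, mul_neg, neg_neg, ← mul_assoc, hYX, hY1]
    abel
  · rw [← MulOpposite.op_mul, ← MulOpposite.op_mul, ← MulOpposite.op_sub]
    congr 1
    simp only [neg_mul, mul_neg, neg_neg, hY1]
    abel
  · rw [MulOpposite.op_neg]
    exact neg_mem (Algebra.subset_adjoin ⟨1, rfl⟩)
  · rintro _ ⟨k, rfl⟩ _ ⟨l, rfl⟩
    exact MulOpposite.unop_injective (δδ k l).eq.symm
  · rintro _ ⟨k, rfl⟩
    have hk : δ k * Y = Y * δ k - (k : ℂ) • δ k := by rw [← Yδ k]; abel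
    have : MulOpposite.op (-X + δ 1 * Y) * MulOpposite.op (δ k)
        - MulOpposite.op (δ k) * MulOpposite.op (-X + δ 1 * Y)
        = MulOpposite.op (δ (k + 1))
          + (-(k : ℂ)) • (MulOpposite.op (δ k) * MulOpposite.op (δ 1)) := by
      rw [← MulOpposite.op_mul, ← MulOpposite.op_mul, ← MulOpposite.op_mul,
        ← MulOpposite.op_sub, ← MulOpposite.op_smul, ← MulOpposite.op_add]
      congr 1
      rw [mul_add, add_mul, ← mul_assoc, (δδ k 1).eq, mul_assoc, hk, ← Xδ k, mul_sub,
        mul_smul_comm, neg_smul, mul_assoc]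
      simp only [neg_mul, mul_neg]
      abel
    simp only [this]
    refine add_mem (Algebra.subset_adjoin ⟨k + 1, rfl⟩) (Subalgebra.smul_mem _ ?_ _)
    exact mul_mem (Algebra.subset_adjoin ⟨k, rfl⟩) (Algebra.subset_adjoin ⟨1, rfl⟩)

/-- The antipode of `ℋ₁`: the algebra anti-homomorphism with `S X = -X + δ_1 Y`, `S Y = -Y`,
`S δ_1 = -δ_1`. -/
def antipodeHom : H1 →ₐ[ℂ] H1ᵐᵒᵖ :=
  lift (MulOpposite.op (-X + δ 1 * Y)) (MulOpposite.op (-Y)) (MulOpposite.op (-δ 1)) antipode_rel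

theorem comulHom_X : comulHom X = X ⊗ₜ[ℂ] (1 : H1) + (1 : H1) ⊗ₜ[ℂ] X + δ 1 ⊗ₜ[ℂ] Y :=
  lift_X _ _ _ _
theorem comulHom_Y : comulHom Y = Y ⊗ₜ[ℂ] (1 : H1) + (1 : H1) ⊗ₜ[ℂ] Y := lift_Y _ _ _ _
theorem comulHom_δ : comulHom (δ 1) = δ 1 ⊗ₜ[ℂ] (1 : H1) + (1 : H1) ⊗ₜ[ℂ] δ 1 := lift_δ _ _ _ _
theorem counitHom_X : counitHom X = 0 := lift_X _ _ _ _
theorem counitHom_Y : counitHom Y = 0 := lift_Y _ _ _ _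
theorem counitHom_δ : counitHom (δ 1) = 0 := lift_δ _ _ _ _
theorem antipodeHom_X : antipodeHom X = MulOpposite.op (-X + δ 1 * Y) := lift_X _ _ _ _
theorem antipodeHom_Y : antipodeHom Y = MulOpposite.op (-Y) := lift_Y _ _ _ _
theorem antipodeHom_δ : antipodeHom (δ 1) = MulOpposite.op (-δ 1) := lift_δ _ _ _ _

instance : Bialgebra ℂ H1 :=
  Bialgebra.ofAlgHom comulHom counitHom
    (by
      apply hom_ext <;>
      · simp [comulHom_X, comulHom_Y, comulHom_δ, TensorProduct.add_tmul, TensorProduct.tmul_add,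
          Algebra.TensorProduct.one_def]
        try abel)
    (by
      apply hom_ext <;>
        simp [comulHom_X, comulHom_Y, comulHom_δ, counitHom_X, counitHom_Y, counitHom_δ])
    (by
      apply hom_ext <;>
        simp [comulHom_X, comulHom_Y, comulHom_δ, counitHom_X, counitHom_Y, counitHom_δ])

theorem comul_eq (a : H1) : Coalgebra.comul (R := ℂ) a = comulHom a := rfl
theorem counit_eq (a : H1) : Coalgebra.counit (R := ℂ) a = counitHom a := rfl

/-- The antipode as a linear map. -/
def antipodeLin : H1 →ₗ[ℂ] H1 :=
  (MulOpposite.opLinearEquiv ℂ).symm.toLinearMap ∘ₗ antipodeHom.toLinearMap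

theorem antipodeLin_apply (a : H1) : antipodeLin a = (antipodeHom a).unop := rfl

theorem antipode_spec (a : H1) :
    LinearMap.mul' ℂ H1 (antipodeLin.rTensor H1 (Coalgebra.comul a))
        = algebraMap ℂ H1 (Coalgebra.counit a) ∧
      LinearMap.mul' ℂ H1 (antipodeLin.lTensor H1 (Coalgebra.comul a))
        = algebraMap ℂ H1 (Coalgebra.counit a) := by
  refine antipode_aux antipodeHom {X, Y, δ 1} adjoin_eq_top antipodeLin antipodeLin_apply ?_ a
  rintro _ (rfl | rfl | rfl) <;>
    simp [comul_eq, counit_eq, comulHom_X, comulHom_Y, comulHom_δ, counitHom_X, counitHom_Y,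
      counitHom_δ, antipodeLin_apply, antipodeHom_X, antipodeHom_Y, antipodeHom_δ]

/-- The Connes–Moscovici Hopf algebra `ℋ₁`. -/
instance : HopfAlgebra ℂ H1 where
  antipode := antipodeLin
  mul_antipode_rTensor_comul := LinearMap.ext fun a => (antipode_spec a).1
  mul_antipode_lTensor_comul := LinearMap.ext fun a => (antipode_spec a).2

end H1

/-! ### The Hopf algebra `𝔥₁ = U(𝔩₁)` -/

/-- The generators `X`, `Y` of `𝔩₁`. -/
inductive SmallGen : Type
  | X : SmallGen
  | Y : SmallGen

/-- The relation `[Y, X] = X`. -/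
inductive relSmall : Set (FreeLieAlgebra ℂ SmallGen)
  | YX : relSmall (⁅FreeLieAlgebra.of ℂ SmallGen.Y, FreeLieAlgebra.of ℂ SmallGen.X⁆
      - FreeLieAlgebra.of ℂ SmallGen.X)

/-- The algebra underlying the Hopf algebra `𝔥₁`: the universal enveloping algebra of the Lie
algebra `𝔩₁` with generators `X`, `Y` and the relation `[Y, X] = X`. -/
def SmallH1 : Type := PresentedU relSmall

instance : Ring SmallH1 := inferInstanceAs (Ring (PresentedU relSmall))
instance : Algebra ℂ SmallH1 := inferInstanceAs (Algebra ℂ (PresentedU relSmall))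

namespace SmallH1

/-- The element `X` of `𝔥₁`. -/
def X : SmallH1 := PresentedU.of relSmall SmallGen.X
/-- The element `Y` of `𝔥₁`. -/
def Y : SmallH1 := PresentedU.of relSmall SmallGen.Y

theorem YX : Y * X - X * Y = X := by
  have h := PresentedU.rel relSmall.YX
  simp only [map_sub, LieHom.map_lie, FreeLieAlgebra.lift_of_apply, sub_eq_zero] at h
  exact h

/-- The images of the generators. -/
def genMap {A : Type} (x y : A) : SmallGen → A
  | SmallGen.X => x
  | SmallGen.Y => y

/-- The algebra map from `𝔥₁` with prescribed values on `X`, `Y`. -/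
def lift {A : Type} [Ring A] [Algebra ℂ A] (x y : A) (h : y * x - x * y = x) :
    SmallH1 →ₐ[ℂ] A :=
  PresentedU.lift relSmall (genMap x y) (by
    intro r hr
    cases hr with
    | YX =>
      simp only [map_sub, LieHom.map_lie, FreeLieAlgebra.lift_of_apply, sub_eq_zero]
      exact h)

section
variable {A : Type} [Ring A] [Algebra ℂ A] (x y : A) (h : y * x - x * y = x)

theorem lift_X : lift x y h X = x := PresentedU.lift_of relSmall (genMap x y) _ SmallGen.X
theorem lift_Y : lift x y h Y = y := PresentedU.lift_of relSmall (genMap x y) _ SmallGen.Y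

end

theorem hom_ext {A : Type} [Ring A] [Algebra ℂ A] {f g : SmallH1 →ₐ[ℂ] A} (hX : f X = g X)
    (hY : f Y = g Y) : f = g := by
  apply PresentedU.hom_ext (R := relSmall)
  intro z
  cases z with
  | X => exact hX
  | Y => exact hY

theorem adjoin_eq_top : Algebra.adjoin ℂ ({X, Y} : Set SmallH1) = ⊤ := by
  have mX : X ∈ Algebra.adjoin ℂ ({X, Y} : Set SmallH1) := Algebra.subset_adjoin (by simp)
  have mY : Y ∈ Algebra.adjoin ℂ ({X, Y} : Set SmallH1) := Algebra.subset_adjoin (by simp)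
  rw [eq_top_iff]
  rintro a -
  let W := Algebra.adjoin ℂ ({X, Y} : Set SmallH1)
  have hr : (⟨Y, mY⟩ : W) * ⟨X, mX⟩ - ⟨X, mX⟩ * ⟨Y, mY⟩ = ⟨X, mX⟩ := Subtype.ext YX
  have he : W.val.comp (lift _ _ hr) = AlgHom.id ℂ SmallH1 := by
    apply hom_ext
    · simp [lift_X]
    · simp [lift_Y]
  have := DFunLike.congr_fun he a
  rw [AlgHom.id_apply] at this
  rw [← this]
  exact (lift _ _ hr a).2

/-- The coproduct of `𝔥₁`, for which `X` and `Y` are primitive. -/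
def comulHom : SmallH1 →ₐ[ℂ] SmallH1 ⊗[ℂ] SmallH1 :=
  lift (X ⊗ₜ[ℂ] (1 : SmallH1) + (1 : SmallH1) ⊗ₜ[ℂ] X)
    (Y ⊗ₜ[ℂ] (1 : SmallH1) + (1 : SmallH1) ⊗ₜ[ℂ] Y) (by
      have hYX : Y * X = X * Y + X := sub_eq_iff_eq_add'.1 YX
      simp only [add_mul, mul_add, Algebra.TensorProduct.tmul_mul_tmul, one_mul, mul_one, hYX,
        TensorProduct.add_tmul, TensorProduct.tmul_add]
      abel)

/-- The counit of `𝔥₁`. -/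
def counitHom : SmallH1 →ₐ[ℂ] ℂ := lift 0 0 (by simp)

/-- The antipode of `𝔥₁`: the algebra anti-homomorphism with `S X = -X`, `S Y = -Y`. -/
def antipodeHom : SmallH1 →ₐ[ℂ] SmallH1ᵐᵒᵖ :=
  lift (MulOpposite.op (-X)) (MulOpposite.op (-Y)) (by
    have hYX : Y * X = X * Y + X := sub_eq_iff_eq_add'.1 YX
    rw [← MulOpposite.op_mul, ← MulOpposite.op_mul, ← MulOpposite.op_sub]
    congr 1
    simp only [neg_mul, mul_neg, neg_neg, hYX]
    abel)

theorem comulHom_X : comulHom X = X ⊗ₜ[ℂ] (1 : SmallH1) + (1 : SmallH1) ⊗ₜ[ℂ] X := lift_X _ _ _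
theorem comulHom_Y : comulHom Y = Y ⊗ₜ[ℂ] (1 : SmallH1) + (1 : SmallH1) ⊗ₜ[ℂ] Y := lift_Y _ _ _
theorem counitHom_X : counitHom X = 0 := lift_X _ _ _
theorem counitHom_Y : counitHom Y = 0 := lift_Y _ _ _
theorem antipodeHom_X : antipodeHom X = MulOpposite.op (-X) := lift_X _ _ _
theorem antipodeHom_Y : antipodeHom Y = MulOpposite.op (-Y) := lift_Y _ _ _

instance : Bialgebra ℂ SmallH1 :=
  Bialgebra.ofAlgHom comulHom counitHom
    (by
      apply hom_ext <;>
      · simp [comulHom_X, comulHom_Y, TensorProduct.add_tmul, TensorProduct.tmul_add,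
          Algebra.TensorProduct.one_def]
        try abel)
    (by apply hom_ext <;> simp [comulHom_X, comulHom_Y, counitHom_X, counitHom_Y])
    (by apply hom_ext <;> simp [comulHom_X, comulHom_Y, counitHom_X, counitHom_Y])

theorem comul_eq (a : SmallH1) : Coalgebra.comul (R := ℂ) a = comulHom a := rfl
theorem counit_eq (a : SmallH1) : Coalgebra.counit (R := ℂ) a = counitHom a := rfl

/-- The antipode as a linear map. -/
def antipodeLin : SmallH1 →ₗ[ℂ] SmallH1 :=
  (MulOpposite.opLinearEquiv ℂ).symm.toLinearMap ∘ₗ antipodeHom.toLinearMap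

theorem antipodeLin_apply (a : SmallH1) : antipodeLin a = (antipodeHom a).unop := rfl

theorem antipode_spec (a : SmallH1) :
    LinearMap.mul' ℂ SmallH1 (antipodeLin.rTensor SmallH1 (Coalgebra.comul a))
        = algebraMap ℂ SmallH1 (Coalgebra.counit a) ∧
      LinearMap.mul' ℂ SmallH1 (antipodeLin.lTensor SmallH1 (Coalgebra.comul a))
        = algebraMap ℂ SmallH1 (Coalgebra.counit a) := by
  refine antipode_aux antipodeHom {X, Y} adjoin_eq_top antipodeLin antipodeLin_apply ?_ a
  rintro _ (rfl | rfl) <;>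
    simp [comul_eq, counit_eq, comulHom_X, comulHom_Y, counitHom_X, counitHom_Y,
      antipodeLin_apply, antipodeHom_X, antipodeHom_Y]

/-- The Hopf algebra `𝔥₁`. -/
instance : HopfAlgebra ℂ SmallH1 where
  antipode := antipodeLin
  mul_antipode_rTensor_comul := LinearMap.ext fun a => (antipode_spec a).1
  mul_antipode_lTensor_comul := LinearMap.ext fun a => (antipode_spec a).2

end SmallH1

/-- The compatibility of an action `ρ` of a Hopf algebra `H` on a vector space `A` with a bilinear
product on `A`: `h(a b) = ∑ h₍₁₎(a) h₍₂₎(b)`, where `Δ h = ∑ h₍₁₎ ⊗ h₍₂₎`. -/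
def IsHopfAction {H A : Type} [Ring H] [HopfAlgebra ℂ H] [AddCommGroup A] [Module ℂ A]
    (mul : A →ₗ[ℂ] A →ₗ[ℂ] A) (ρ : H →ₐ[ℂ] Module.End ℂ A) : Prop :=
  ∀ (h : H) (a b : A), ρ h (mul a b) =
    TensorProduct.lift (mul.compl₁₂ (ρ.toLinearMap.flip a) (ρ.toLinearMap.flip b))
      (Coalgebra.comul (R := ℂ) h)

/-! ### Modular and quasimodular forms -/

/-- Holomorphic modular forms of weight `m` for some `Γ(N)`, `N ≥ 1`. This is the weight `m` part
of the modular tower. -/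
def modTower (m : ℕ) : Submodule ℂ (ℍ → ℂ) :=
  Submodule.span ℂ {f | ∃ N : ℕ, 1 ≤ N ∧
    ∃ g : ModularForm ((CongruenceSubgroup.Gamma N).map (Matrix.SpecialLinearGroup.mapGL ℝ)) m,
      ⇑g = f}

theorem modTower_mdifferentiable {m : ℕ} {f : ℍ → ℂ} (hf : f ∈ modTower m) : MDiff f := by
  induction hf using Submodule.span_induction with
  | mem f hf => obtain ⟨N, -, g, rfl⟩ := hf; exact ModularFormClass.holo g
  | zero => exact mdifferentiable_const
  | add f g _ _ hf hg => exact hf.add hg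
  | smul c f _ hf => exact hf.const_smul c

/-- Quasimodular forms of level `Γ(N)`, weight `k` and depth `s`. The component functions are
holomorphic on `ℍ` and at the cusps. -/
def IsQuasimodular (N k s : ℕ) (f : ℍ → ℂ) : Prop :=
  (f = 0 ∧ s = 0) ∨
  (MDiff f ∧ ∃ F : ℕ → ℍ → ℂ,
    (∀ j ≤ s, MDiff (F j) ∧ ∀ γ : SL(2, ℤ),
      UpperHalfPlane.IsBoundedAtImInfty (F j ∣[(k : ℤ) - 2 * j] γ)) ∧
    F s ≠ 0 ∧
    ∀ γ ∈ CongruenceSubgroup.Gamma N, ∀ z : ℍ,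
      (((γ 1 0 : ℤ) : ℂ) * z + ((γ 1 1 : ℤ) : ℂ)) ^ (-(k : ℤ)) * f (γ • z) =
        ∑ j ∈ Finset.range (s + 1),
          F j z * (((γ 1 0 : ℤ) : ℂ) / (((γ 1 0 : ℤ) : ℂ) * z + ((γ 1 1 : ℤ) : ℂ))) ^ j)

/-- The quasimodular tower `𝒬ℳ`: all finite sums of quasimodular forms of arbitrary levels
`Γ(N)`, `N ≥ 1`, weights and depths, as functions on the upper half plane. (Quasimodular forms of
different weights are linearly independent, so this is the direct sum over all weights of the
unions over all levels and depths.) -/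
def QM : Submodule ℂ (ℍ → ℂ) :=
  Submodule.span ℂ {f | ∃ N k s : ℕ, 1 ≤ N ∧ IsQuasimodular N k s f}

/-- The Eisenstein series `G₂(z) = -B₂/4 + ∑_{n ≥ 1} σ₁(n) e^{2πinz}`. -/
def G2 (z : ℍ) : ℂ :=
  -((bernoulli 2 : ℚ) : ℂ) / (2 * 2) +
    ∑' n : ℕ+, (ArithmeticFunction.sigma 1 (n : ℕ) : ℂ) *
      Complex.exp (2 * Real.pi * Complex.I * n * z)

/-- The derivative `d/dz` of a function on the upper half plane. -/
def ddz (f : ℍ → ℂ) (z : ℍ) : ℂ := deriv (f ∘ UpperHalfPlane.ofComplex) z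

/-- The logarithmic derivative `d/dz (log f) = f' / f`. -/
def dlog (f : ℍ → ℂ) (z : ℍ) : ℂ := ddz f z / f z

/-- `Δ(z) = (2π)¹² q ∏ (1 - qⁿ)²⁴`, `q = e^{2πiz}`. -/
def Delta (z : ℍ) : ℂ :=
  (2 * Real.pi) ^ 12 * (Complex.exp (2 * Real.pi * Complex.I * z) *
    ∏' n : ℕ+, (1 - Complex.exp (2 * Real.pi * Complex.I * z) ^ (n : ℕ)) ^ 24)

/-- The real matrix of an element of `GL₂⁺(ℚ)`. -/
def toGLR (α : Matrix.GLPos (Fin 2) ℚ) : GL (Fin 2) ℝ :=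
  Matrix.GeneralLinearGroup.map (algebraMap ℚ ℝ) (α : GL (Fin 2) ℚ)

/-- The weight `m` action `(f|_m α)(z) = det(α)^{m/2} (cz+d)^{-m} f((az+b)/(cz+d))` of
`GL₂⁺(ℚ)`. -/
def slash (m : ℕ) (α : Matrix.GLPos (Fin 2) ℚ) : (ℍ → ℂ) →ₗ[ℂ] (ℍ → ℂ) where
  toFun f z := ((((toGLR α).det.val : ℝ) ^ ((m : ℝ) / 2) : ℝ) : ℂ) *
    UpperHalfPlane.denom (toGLR α) z ^ (-(m : ℤ)) * f (toGLR α • z)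
  map_add' f g := by ext z; simp only [Pi.add_apply]; ring
  map_smul' c f := by ext z; simp only [Pi.smul_apply, smul_eq_mul, RingHom.id_apply]; ring

/-- The finite families `(a_{m,i})` of modular forms, with `a_{m,i}` of weight `m`, standing for
the polynomials `∑ a_{m,i} G₂^i`. -/
abbrev Coeffs : Type := ⨁ p : ℕ × ℕ, modTower p.1

/-- `(a_{m,i}) ↦ ∑ T_m(a_{m,i}) G₂^i` for a family of maps `T_m` on modular forms. -/
def applyCoeffs (T : ∀ m : ℕ, modTower m →ₗ[ℂ] (ℍ → ℂ)) : Coeffs →ₗ[ℂ] (ℍ → ℂ) :=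
  DirectSum.toModule ℂ (ℕ × ℕ) (ℍ → ℂ)
    (fun p => LinearMap.mulRight ℂ (G2 ^ p.2) ∘ₗ T p.1)

/-- `(a_{m,i}) ↦ ∑ a_{m,i} G₂^i`. By the structure theorem for quasimodular forms this is a
bijection onto `𝒬ℳ`. -/
def expand : Coeffs →ₗ[ℂ] (ℍ → ℂ) := applyCoeffs fun m => (modTower m).subtype

/-- The coefficients `a_{m,i}(f)` of `f = ∑ a_{m,i}(f) G₂^i ∈ 𝒬ℳ` (a linear left inverse
of the injective map `expand`; its values outside `𝒬ℳ` are irrelevant). -/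
def coeffs : (ℍ → ℂ) →ₗ[ℂ] Coeffs :=
  LinearMap.leftInverse (K := ℂ) (V := Coeffs) (V' := ℍ → ℂ) expand

/-- The operation `f‖α = ∑ (a_i(f)|α) G₂^i` on `𝒬ℳ`. -/
def qslash (α : Matrix.GLPos (Fin 2) ℚ) : (ℍ → ℂ) →ₗ[ℂ] (ℍ → ℂ) :=
  applyCoeffs (fun m => slash m α ∘ₗ (modTower m).subtype) ∘ₗ coeffs

/-- `Y(f) = (m/2) f` for a modular form of weight `m`. -/
def modY (m : ℕ) : modTower m →ₗ[ℂ] (ℍ → ℂ) := ((m : ℂ) / 2) • (modTower m).subtype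

/-- The Ramanujan differential operator `X(f) = (1/2πi) f' - (1/12πi) (log Δ)' Y(f)` on modular
forms of weight `m`. -/
def modX (m : ℕ) : modTower m →ₗ[ℂ] (ℍ → ℂ) where
  toFun f z := 1 / (2 * Real.pi * Complex.I) * ddz f z
    - 1 / (12 * Real.pi * Complex.I) * dlog Delta z * modY m f z
  map_add' f g := by
    ext z
    have hf := UpperHalfPlane.mdifferentiableAt_iff.mp (modTower_mdifferentiable f.2 z)
    have hg := UpperHalfPlane.mdifferentiableAt_iff.mp (modTower_mdifferentiable g.2 z)
    have h : ddz ((f : ℍ → ℂ) + (g : ℍ → ℂ)) z = ddz f z + ddz g z := deriv_add hf hg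
    simp only [map_add, Pi.add_apply, Submodule.coe_add, h]
    ring
  map_smul' c f := by
    ext z
    have hf := UpperHalfPlane.mdifferentiableAt_iff.mp (modTower_mdifferentiable f.2 z)
    have h : ddz (c • (f : ℍ → ℂ)) z = c * ddz f z := deriv_const_smul c hf
    simp only [map_smul, Pi.smul_apply, Submodule.coe_smul, h, smul_eq_mul, RingHom.id_apply]
    ring

/-- The operator `X(f) = ∑ X(a_i(f)) G₂^i` on `𝒬ℳ`. -/
def opX : (ℍ → ℂ) →ₗ[ℂ] (ℍ → ℂ) := applyCoeffs modX ∘ₗ coeffs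

/-- The operator `Y(f) = ∑ Y(a_i(f)) G₂^i` on `𝒬ℳ`. -/
def opY : (ℍ → ℂ) →ₗ[ℂ] (ℍ → ℂ) := applyCoeffs modY ∘ₗ coeffs

/-- `μ_α = (1/12πi) d/dz log((Δ|α)/Δ)`. -/
def mu (α : Matrix.GLPos (Fin 2) ℚ) (z : ℍ) : ℂ :=
  1 / (12 * Real.pi * Complex.I) * dlog (fun w => slash 12 α Delta w / Delta w) z

/-! ### Quasimodular Hecke operators -/

/-- The inclusion `SL₂(ℤ) → GL₂⁺(ℚ)`. -/
def inclSL : SL(2, ℤ) →* Matrix.GLPos (Fin 2) ℚ :=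
  Matrix.SpecialLinearGroup.toGLPos.comp (Matrix.SpecialLinearGroup.map (Int.castRingHom ℚ))

/-- `Γ(N)` as a subgroup of `GL₂⁺(ℚ)`. -/
def GammaQ (N : ℕ) : Subgroup (Matrix.GLPos (Fin 2) ℚ) := (CongruenceSubgroup.Gamma N).map inclSL

/-- The set of cosets `Γ(N) \ GL₂⁺(ℚ)`. -/
abbrev Cosets (N : ℕ) : Type := Quotient (QuotientGroup.rightRel (GammaQ N))

/-- The space `𝒬(Γ(N))` of quasimodular Hecke operators of level `Γ(N)`: the functions
`F : Γ(N) \ GL₂⁺(ℚ) → 𝒬ℳ` of finite support with `F_{αγ} = F_α‖γ` for `γ ∈ Γ(N)`. -/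
def QHecke (N : ℕ) : Submodule ℂ (Matrix.GLPos (Fin 2) ℚ → ℍ → ℂ) where
  carrier := {F | (∀ α, F α ∈ QM) ∧ (∀ γ ∈ GammaQ N, ∀ α, F (γ * α) = F α) ∧
    ((fun α => (Quotient.mk _ α : Cosets N)) '' {α | F α ≠ 0}).Finite ∧
    ∀ γ ∈ GammaQ N, ∀ α, F (α * γ) = qslash γ (F α)}
  zero_mem' := by
    refine ⟨fun α => QM.zero_mem, fun _ _ _ => rfl, by simp, fun γ _ α => ?_⟩
    simp only [Pi.zero_apply, map_zero]
  add_mem' := by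
    rintro F G ⟨h1, h2, h3, h4⟩ ⟨k1, k2, k3, k4⟩
    refine ⟨fun α => QM.add_mem (h1 α) (k1 α), fun γ hγ α => ?_, ?_, fun γ hγ α => ?_⟩
    · simp only [Pi.add_apply, h2 γ hγ, k2 γ hγ]
    · apply (h3.union k3).subset
      rw [← Set.image_union]
      apply Set.image_mono
      intro α hα
      by_contra hc
      simp only [Set.mem_union, Set.mem_ofPred_eq, not_or, not_not] at hc
      exact hα (by rw [Pi.add_apply, hc.1, hc.2, add_zero])
    · simp only [Pi.add_apply, h4 γ hγ, k4 γ hγ, map_add]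
  smul_mem' := by
    rintro c F ⟨h1, h2, h3, h4⟩
    refine ⟨fun α => QM.smul_mem c (h1 α), fun γ hγ α => ?_, ?_, fun γ hγ α => ?_⟩
    · simp only [Pi.smul_apply, h2 γ hγ]
    · apply h3.subset
      apply Set.image_mono
      intro α hα hc
      exact hα (by rw [Pi.smul_apply, hc, smul_zero])
    · simp only [Pi.smul_apply, h4 γ hγ, map_smul]

/-- The product `(F ∗ G)_α = ∑_{β ∈ Γ(N) \ GL₂⁺(ℚ)} F_β · (G_{αβ⁻¹}‖β)`. -/
def heckeMul (N : ℕ) (F G : Matrix.GLPos (Fin 2) ℚ → ℍ → ℂ) (α : Matrix.GLPos (Fin 2) ℚ) : ℍ → ℂ :=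
  ∑ᶠ β : Cosets N, F β.out * qslash β.out (G (α * β.out⁻¹))

/-- The product `(F ∗ʳ G)_α = ∑_{β ∈ Γ(N) \ SL₂(ℤ)} F_β · (G_{αβ⁻¹}‖β)`. -/
def heckeMulR (N : ℕ) (F G : Matrix.GLPos (Fin 2) ℚ → ℍ → ℂ) (α : Matrix.GLPos (Fin 2) ℚ) : ℍ → ℂ :=
  ∑ᶠ β : Quotient (QuotientGroup.rightRel (CongruenceSubgroup.Gamma N)),
    F (inclSL β.out) * qslash (inclSL β.out) (G (α * (inclSL β.out)⁻¹))

end QMHecke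

end

/-!
A modular form `f` of weight `m` satisfies `X(f|α) = X(f)|α + μ_α Y(f|α)`, because `Δ'/Δ` is a
multiple of `E₂` and `μ` measures the failure of `E₂` to be modular of weight two; moreover `μ` is a
cocycle, `μ_{αβ} = μ_α|β + μ_β`, and it vanishes on `SL₂(ℤ)`. To transfer this to `𝒬ℳ` one needs
`𝒬ℳ = 𝓜[G₂]`. Here the coefficients are unique since, for a fixed `z`, the transformation law of
`G₂` turns a relation into a polynomial in `c/(cz+d)` which vanishes for infinitely many pairs
`(c, d)`; and every quasimodular form is a polynomial in `G₂` because its top component is modular,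
so that a multiple of `G₂^s` can be subtracted to lower the depth `s`.

Right equivariance says that a Hecke operator `G` is fixed by the translates
`G ↦ (α ↦ G_{αβ⁻¹}‖β)` with `β ∈ Γ`. Since these translates form an action, the products `∗` and
`∗ʳ` are independent of representatives and associative.

The elements of a bialgebra that act compatibly with the coproduct form a subalgebra, so it is
enough to verify the Leibniz rules of `X`, `Y` and `δ₁`. The rule for `X` is the formula above, with
`δ₁` producing the extra term, and the rule for `δ₁` is the cocycle identity. For `∗ʳ` the extra
term is zero since `μ` vanishes on `SL₂(ℤ)`.
-/

noncomputable section

namespace QMHecke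

open UpperHalfPlane EisensteinSeries Derivative CongruenceSubgroup

/-! ### The slash action of `GL₂⁺(ℚ)` -/

section SlashAction

variable {m : ℕ} {α : GL(2, ℚ)⁺} {f : ℍ → ℂ}

theorem toGLR_mul (α β : GL(2, ℚ)⁺) : toGLR (α * β) = toGLR α * toGLR β := by
  simp [toGLR]

theorem toGLR_one : toGLR 1 = 1 := by simp [toGLR]

theorem det_toGLR_pos (α : GL(2, ℚ)⁺) : 0 < (toGLR α).det.val := by
  have hα : 0 < (α : GL (Fin 2) ℚ).det.val := α.2
  have hdet : (toGLR α).det.val = (α : GL (Fin 2) ℚ).det.val := by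
    simp [toGLR, Matrix.det_fin_two]
  rw [hdet]
  exact_mod_cast hα

theorem ofReal_det_toGLR_ne_zero (α : GL(2, ℚ)⁺) : ((toGLR α).det.val : ℂ) ≠ 0 :=
  Complex.ofReal_ne_zero.2 (det_toGLR_pos α).ne'

theorem coe_inclSL (γ : SL(2, ℤ)) :
    (inclSL γ : GL (Fin 2) ℚ) = Matrix.SpecialLinearGroup.mapGL ℚ γ := by
  ext i j
  simp [inclSL]

theorem toGLR_inclSL (γ : SL(2, ℤ)) :
    toGLR (inclSL γ) = Matrix.SpecialLinearGroup.mapGL ℝ γ := by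
  ext i j
  simp [toGLR, inclSL]

theorem σ_toGLR (α : GL(2, ℚ)⁺) (z : ℂ) : σ (toGLR α) z = z := by
  rw [σ, if_pos (det_toGLR_pos α), ContinuousAlgEquiv.refl_apply]

theorem denom_toGLR_mul (α β : GL(2, ℚ)⁺) (z : ℍ) :
    denom (toGLR (α * β)) z = denom (toGLR α) (toGLR β • z : ℍ) * denom (toGLR β) z := by
  rw [toGLR_mul, denom_cocycle_σ, σ_toGLR]

/-- The normalising factor `det(α)^{m/2}` of the weight `m` action of `GL₂⁺(ℚ)`. -/
def detFactor (m : ℕ) (α : GL(2, ℚ)⁺) : ℂ := ((toGLR α).det.val ^ ((m : ℝ) / 2) : ℝ)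

theorem detFactor_mul (m : ℕ) (α β : GL(2, ℚ)⁺) :
    detFactor m (α * β) = detFactor m α * detFactor m β := by
  rw [detFactor, toGLR_mul, map_mul, Units.val_mul,
    Real.mul_rpow (det_toGLR_pos α).le (det_toGLR_pos β).le, Complex.ofReal_mul, detFactor,
    detFactor]

theorem detFactor_add (m n : ℕ) (α : GL(2, ℚ)⁺) :
    detFactor (m + n) α = detFactor m α * detFactor n α := by
  rw [detFactor, Nat.cast_add, add_div, Real.rpow_add (det_toGLR_pos α), Complex.ofReal_mul,
    detFactor, detFactor]

theorem detFactor_two (α : GL(2, ℚ)⁺) : detFactor 2 α = (toGLR α).det.val := by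
  simp [detFactor]

theorem detFactor_one (m : ℕ) : detFactor m 1 = 1 := by
  simp [detFactor, toGLR_one]

theorem detFactor_inclSL (m : ℕ) (γ : SL(2, ℤ)) : detFactor m (inclSL γ) = 1 := by
  simp [detFactor, toGLR_inclSL]

theorem detFactor_ne_zero (m : ℕ) (α : GL(2, ℚ)⁺) : detFactor m α ≠ 0 :=
  Complex.ofReal_ne_zero.2 (Real.rpow_pos_of_pos (det_toGLR_pos α) _).ne'

theorem slash_apply (m : ℕ) (α : GL(2, ℚ)⁺) (f : ℍ → ℂ) (z : ℍ) :
    slash m α f z = detFactor m α * denom (toGLR α) z ^ (-(m : ℤ)) * f (toGLR α • z) := rfl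

theorem slash_slash (m : ℕ) (α β : GL(2, ℚ)⁺) (f : ℍ → ℂ) :
    slash m β (slash m α f) = slash m (α * β) f := by
  ext z
  simp only [slash_apply]
  rw [detFactor_mul, denom_toGLR_mul, mul_zpow, toGLR_mul, mul_smul]
  ring

theorem slash_one (m : ℕ) (f : ℍ → ℂ) : slash m 1 f = f := by
  ext z
  simp [slash_apply, toGLR_one, detFactor_one]

theorem slash_mul (m n : ℕ) (α : GL(2, ℚ)⁺) (f g : ℍ → ℂ) :
    slash (m + n) α (f * g) = slash m α f * slash n α g := by
  ext z
  simp only [slash_apply, Pi.mul_apply, detFactor_add, Nat.cast_add, neg_add,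
    zpow_add₀ (denom_ne_zero (toGLR α) z)]
  ring

-- Mathlib normalises the slash action by `|det α| ^ (m - 1)` instead of `det(α)^{m/2}`.
theorem slash_eq_smul (m : ℕ) (α : GL(2, ℚ)⁺) (f : ℍ → ℂ) :
    slash m α f =
      (detFactor m α * ((toGLR α).det.val : ℂ) ^ (1 - (m : ℤ))) • (f ∣[(m : ℤ)] toGLR α) := by
  ext z
  have hdet : ((toGLR α).det.val : ℂ) ^ (1 - (m : ℤ)) * (toGLR α).det.val ^ ((m : ℤ) - 1) = 1 := by
    rw [← zpow_add₀ (ofReal_det_toGLR_ne_zero α), sub_add_sub_cancel', sub_self, zpow_zero]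
  rw [Pi.smul_apply, ModularForm.slash_apply, σ_toGLR, abs_of_pos (det_toGLR_pos α), slash_apply,
    smul_eq_mul]
  linear_combination
    (-detFactor m α * denom (toGLR α) z ^ (-(m : ℤ)) * f (toGLR α • z)) * hdet

theorem slash_inclSL (m : ℕ) (γ : SL(2, ℤ)) (f : ℍ → ℂ) :
    slash m (inclSL γ) f = f ∣[(m : ℤ)] γ := by
  rw [slash_eq_smul, detFactor_inclSL, toGLR_inclSL, ModularForm.SL_slash]
  simp only [Matrix.SpecialLinearGroup.det_mapGL, Units.val_one, Complex.ofReal_one, one_zpow,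
    mul_one, one_smul]
  rfl

theorem mdifferentiable_slash (hf : MDiff f) : MDiff (slash m α f) := by
  rw [slash_eq_smul]
  exact (hf.slash _ _).const_smul _

theorem isBoundedAtImInfty_slash (hα : (α : GL (Fin 2) ℚ) 1 0 = 0) (hf : IsBoundedAtImInfty f) :
    IsBoundedAtImInfty (slash m α f) := by
  rw [slash_eq_smul]
  refine Filter.BoundedAtFilter.smul _ (hf.slash m ?_)
  simp [toGLR, hα]

theorem exists_inclSL_mul_upperTriangular (α : GL(2, ℚ)⁺) :
    ∃ (γ : SL(2, ℤ)) (τ : GL(2, ℚ)⁺), α = inclSL γ * τ ∧ (τ : GL (Fin 2) ℚ) 1 0 = 0 := by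
  obtain ⟨γ, hγ⟩ := OnePoint.exists_mem_SL2 ℤ ((α : GL (Fin 2) ℚ) • (OnePoint.infty : OnePoint ℚ))
  refine ⟨γ, (inclSL γ)⁻¹ * α, (mul_inv_cancel_left _ _).symm, ?_⟩
  rw [← OnePoint.smul_infty_eq_self_iff, Subgroup.coe_mul, Subgroup.coe_inv, mul_smul, coe_inclSL,
    inv_smul_eq_iff, hγ]

theorem exists_Gamma_conj_mem_Gamma (α : GL(2, ℚ)⁺) {N : ℕ} (hN : 1 ≤ N) :
    ∃ M, 1 ≤ M ∧ ∀ γ ∈ Γ(M), ∃ γ' ∈ Γ(N), α * inclSL γ = inclSL γ' * α := by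
  have : NeZero N := ⟨by omega⟩
  obtain ⟨M, hM, hconj⟩ := exists_Gamma_le_conj (α : GL (Fin 2) ℚ) N
  refine ⟨M, Nat.one_le_iff_ne_zero.2 hM, fun γ hγ => ?_⟩
  obtain ⟨γ', hγ', h⟩ := hconj γ hγ
  refine ⟨γ', hγ', Subtype.ext ?_⟩
  rw [Subgroup.coe_mul, Subgroup.coe_mul, coe_inclSL, coe_inclSL, h, inv_mul_cancel_right]

end SlashAction

/-! ### The modular tower -/

section ModularTower

variable {N : ℕ} {k : ℤ} {f g : ℍ → ℂ}

/-- Modular forms of weight `k` for `Γ(N)`, as a predicate on functions, so that forms of different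
levels can be compared; negative weights are allowed. -/
structure IsModular (N : ℕ) (k : ℤ) (f : ℍ → ℂ) : Prop where
  mdifferentiable : MDiff f
  slash_eq : ∀ γ ∈ Γ(N), f ∣[k] γ = f
  isBoundedAtImInfty : ∀ γ : SL(2, ℤ), IsBoundedAtImInfty (f ∣[k] γ)

namespace IsModular

theorem exists_modularForm (hN : 1 ≤ N) (hf : IsModular N k f) :
    ∃ g : ModularForm (Γ(N).map (Matrix.SpecialLinearGroup.mapGL ℝ)) k, ⇑g = f := by
  have : NeZero N := ⟨by omega⟩
  refine ⟨⟨⟨f, ?_⟩, hf.mdifferentiable, fun hc => ?_⟩, rfl⟩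
  · rintro _ ⟨γ, hγ, rfl⟩
    exact hf.slash_eq γ hγ
  · rw [Subgroup.IsArithmetic.isCusp_iff_isCusp_SL2Z] at hc
    rw [OnePoint.isBoundedAt_iff_forall_SL2Z hc]
    exact fun γ _ => hf.isBoundedAtImInfty γ

theorem of_modularForm (hN : 1 ≤ N)
    (g : ModularForm (Γ(N).map (Matrix.SpecialLinearGroup.mapGL ℝ)) k) : IsModular N k g := by
  have : NeZero N := ⟨by omega⟩
  exact ⟨ModularFormClass.holo g, fun γ hγ => g.slash_action_eq' _ ⟨γ, hγ, rfl⟩,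
    fun γ => ModularFormClass.bdd_at_infty_slash g γ⟩

theorem eq_zero_of_neg (hN : 1 ≤ N) (hk : k < 0) (hf : IsModular N k f) : f = 0 := by
  have : NeZero N := ⟨by omega⟩
  obtain ⟨g, rfl⟩ := hf.exists_modularForm hN
  rw [ModularForm.isZero_of_neg_weight hk g, FunLike.coe_zero]

theorem zero (N : ℕ) (k : ℤ) : IsModular N k 0 where
  mdifferentiable := mdifferentiable_const
  slash_eq _ _ := SlashAction.zero_slash _ _
  isBoundedAtImInfty γ := by
    rw [SlashAction.zero_slash]
    exact zero_form_isBoundedAtImInfty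

theorem one (N : ℕ) : IsModular N 0 1 where
  mdifferentiable := mdifferentiable_const
  slash_eq γ _ := ModularForm.is_invariant_one γ
  isBoundedAtImInfty γ := by
    rw [ModularForm.is_invariant_one γ]
    exact Filter.const_boundedAtFilter _ 1

theorem add (hf : IsModular N k f) (hg : IsModular N k g) : IsModular N k (f + g) where
  mdifferentiable := hf.mdifferentiable.add hg.mdifferentiable
  slash_eq γ hγ := by rw [SlashAction.add_slash, hf.slash_eq γ hγ, hg.slash_eq γ hγ]
  isBoundedAtImInfty γ := by
    rw [SlashAction.add_slash]
    exact (hf.isBoundedAtImInfty γ).add (hg.isBoundedAtImInfty γ)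

theorem smul (c : ℂ) (hf : IsModular N k f) : IsModular N k (c • f) where
  mdifferentiable := hf.mdifferentiable.const_smul c
  slash_eq γ hγ := by rw [ModularForm.SL_smul_slash, hf.slash_eq γ hγ]
  isBoundedAtImInfty γ := by
    rw [ModularForm.SL_smul_slash]
    exact (hf.isBoundedAtImInfty γ).smul c

theorem mul {l : ℤ} (hf : IsModular N k f) (hg : IsModular N l g) :
    IsModular N (k + l) (f * g) where
  mdifferentiable := hf.mdifferentiable.mul hg.mdifferentiable
  slash_eq γ hγ := by rw [ModularForm.mul_slash_SL2, hf.slash_eq γ hγ, hg.slash_eq γ hγ]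
  isBoundedAtImInfty γ := by
    rw [ModularForm.mul_slash_SL2]
    exact (hf.isBoundedAtImInfty γ).mul (hg.isBoundedAtImInfty γ)

end IsModular

theorem Gamma_le_Gamma_of_dvd {M : ℕ} (h : M ∣ N) : Γ(N) ≤ Γ(M) := by
  intro γ hγ
  have hcast (n : ℤ) : (n : ZMod M) = ZMod.castHom h (ZMod M) (n : ZMod N) := (map_intCast _ n).symm
  obtain ⟨h₀₀, h₀₁, h₁₀, h₁₁⟩ := Gamma_mem.1 hγ
  simp only [Gamma_mem, hcast, h₀₀, h₀₁, h₁₀, h₁₁, map_one, map_zero, and_self]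

theorem IsModular.of_dvd {M : ℕ} (h : M ∣ N) (hf : IsModular M k f) : IsModular N k f where
  mdifferentiable := hf.mdifferentiable
  slash_eq γ hγ := hf.slash_eq γ (Gamma_le_Gamma_of_dvd h hγ)
  isBoundedAtImInfty := hf.isBoundedAtImInfty

theorem mem_modTower_iff {m : ℕ} : f ∈ modTower m ↔ ∃ N : ℕ, 1 ≤ N ∧ IsModular N m f := by
  refine ⟨fun hf => ?_, ?_⟩
  · induction hf using Submodule.span_induction with
    | mem f hf =>
      obtain ⟨N, hN, g, rfl⟩ := hf
      exact ⟨N, hN, .of_modularForm hN g⟩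
    | zero => exact ⟨1, le_rfl, .zero _ _⟩
    | add f g _ _ hf hg =>
      obtain ⟨M, hM, hf⟩ := hf
      obtain ⟨N, hN, hg⟩ := hg
      exact ⟨M * N, Nat.mul_pos hM hN,
        (hf.of_dvd (dvd_mul_right _ _)).add (hg.of_dvd (dvd_mul_left _ _))⟩
    | smul c f _ hf =>
      obtain ⟨M, hM, hf⟩ := hf
      exact ⟨M, hM, hf.smul c⟩
  · rintro ⟨N, hN, hf⟩
    exact Submodule.subset_span ⟨N, hN, hf.exists_modularForm hN⟩

theorem mul_mem_modTower {m n : ℕ} (hf : f ∈ modTower m) (hg : g ∈ modTower n) :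
    f * g ∈ modTower (m + n) := by
  obtain ⟨M, hM, hf⟩ := mem_modTower_iff.1 hf
  obtain ⟨N, hN, hg⟩ := mem_modTower_iff.1 hg
  refine mem_modTower_iff.2 ⟨M * N, Nat.mul_pos hM hN, ?_⟩
  rw [Nat.cast_add]
  exact (hf.of_dvd (dvd_mul_right _ _)).mul (hg.of_dvd (dvd_mul_left _ _))

theorem one_mem_modTower : (1 : ℍ → ℂ) ∈ modTower 0 :=
  mem_modTower_iff.2 ⟨1, le_rfl, .one 1⟩

theorem slash_mem_modTower {m : ℕ} (α : GL(2, ℚ)⁺) (hf : f ∈ modTower m) :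
    slash m α f ∈ modTower m := by
  obtain ⟨N, hN, hf⟩ := mem_modTower_iff.1 hf
  obtain ⟨M, hM, hconj⟩ := exists_Gamma_conj_mem_Gamma α hN
  refine mem_modTower_iff.2
    ⟨M, hM, mdifferentiable_slash hf.mdifferentiable, fun γ hγ => ?_, fun γ => ?_⟩
  · obtain ⟨γ', hγ', h⟩ := hconj γ hγ
    rw [← slash_inclSL, slash_slash, h, ← slash_slash, slash_inclSL, hf.slash_eq γ' hγ']
  · obtain ⟨γ', τ, h, hτ⟩ := exists_inclSL_mul_upperTriangular (α * inclSL γ)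
    rw [← slash_inclSL, slash_slash, h, ← slash_slash, slash_inclSL]
    exact isBoundedAtImInfty_slash hτ (hf.isBoundedAtImInfty γ')

end ModularTower

/-! ### The cocycle of `E₂` -/

section LowerRatio

variable (α β : GL(2, ℚ)⁺) (γ : SL(2, ℤ)) (z : ℍ)

/-- The function `c / (cz + d)` attached to a matrix with bottom row `(c, d)`. -/
def lowerRatio (z : ℍ) : ℂ := (toGLR α 1 0 : ℝ) / denom (toGLR α) z

theorem mdifferentiable_lowerRatio : MDiff (lowerRatio α) := by
  have h : lowerRatio α = ((toGLR α 1 0 : ℝ) : ℂ) • fun z : ℍ => (denom (toGLR α) z)⁻¹ := by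
    ext z
    simp [lowerRatio, div_eq_mul_inv]
  rw [h]
  exact (mdifferentiable_inv_denom _).const_smul _

theorem isBoundedAtImInfty_lowerRatio : IsBoundedAtImInfty (lowerRatio α) := by
  refine isBoundedAtImInfty_iff.2 ⟨1, 1, fun z hz => ?_⟩
  have him : |(denom (toGLR α) z).im| ≤ ‖denom (toGLR α) z‖ := Complex.abs_im_le_norm _
  have himeq : (denom (toGLR α) z).im = toGLR α 1 0 * z.im := by simp [denom]
  rw [himeq, abs_mul, abs_of_pos z.im_pos] at him
  rw [lowerRatio, norm_div, Complex.norm_real, Real.norm_eq_abs]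
  refine div_le_one_of_le₀ ?_ (norm_nonneg _)
  nlinarith [abs_nonneg (toGLR α 1 0)]

theorem lowerRatio_mul : lowerRatio (α * β) = slash 2 β (lowerRatio α) + lowerRatio β := by
  ext z
  have hβz : denom (toGLR β) z ≠ 0 := denom_ne_zero _ z
  have hαβz : denom (toGLR α) (toGLR β • z : ℍ) ≠ 0 := denom_ne_zero _ _
  have hdet : ((toGLR β).det.val : ℂ)
      = toGLR β 0 0 * toGLR β 1 1 - toGLR β 0 1 * toGLR β 1 0 := by
    simp [Matrix.det_fin_two]
  have hrow : ((toGLR (α * β) 1 0 : ℝ) : ℂ)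
      = toGLR α 1 0 * toGLR β 0 0 + toGLR α 1 1 * toGLR β 1 0 := by
    simp [toGLR_mul, Matrix.mul_apply, Fin.sum_univ_two]
  have hsmul : ((toGLR β • z : ℍ) : ℂ) * denom (toGLR β) z
      = toGLR β 0 0 * (z : ℂ) + toGLR β 0 1 := by
    rw [coe_smul_of_det_pos (det_toGLR_pos β), div_mul_cancel₀ _ hβz, num]
  have key : (toGLR (α * β) 1 0 : ℝ) * denom (toGLR β) z
      = (toGLR β).det.val * toGLR α 1 0
        + toGLR β 1 0 * (denom (toGLR α) (toGLR β • z : ℍ) * denom (toGLR β) z) := by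
    rw [hrow, hdet]
    have hdenom : denom (toGLR α) (toGLR β • z : ℍ)
        = toGLR α 1 0 * ((toGLR β • z : ℍ) : ℂ) + toGLR α 1 1 := rfl
    have hdenomβ : denom (toGLR β) z = toGLR β 1 0 * (z : ℂ) + toGLR β 1 1 := rfl
    rw [hdenomβ] at hsmul ⊢
    rw [hdenom]
    linear_combination (-(toGLR β 1 0 : ℂ) * toGLR α 1 0) * hsmul
  rw [Pi.add_apply, slash_apply, detFactor_two, Nat.cast_ofNat, zpow_neg, zpow_ofNat]
  simp only [lowerRatio]
  rw [denom_toGLR_mul]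
  field_simp
  linear_combination key

theorem denom_inclSL : denom (toGLR (inclSL γ)) z = denom γ z := by
  rw [toGLR_inclSL]
  rfl

theorem lowerRatio_inclSL : lowerRatio (inclSL γ) z = γ 1 0 / denom γ z := by
  rw [lowerRatio, denom_inclSL, toGLR_inclSL]
  simp

end LowerRatio

theorem pi_mul_I_ne_zero : (Real.pi : ℂ) * Complex.I ≠ 0 :=
  mul_ne_zero (Complex.ofReal_ne_zero.2 Real.pi_ne_zero) Complex.I_ne_zero

theorem G2_eq_smul_E2 : G2 = (-1 / 24 : ℂ) • E2 := by
  ext z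
  have hexp (n : ℕ+) : Complex.exp (2 * Real.pi * Complex.I * n * z)
      = Complex.exp (2 * Real.pi * Complex.I * z) ^ (n : ℕ) := by
    rw [← Complex.exp_nat_mul]
    congr 1
    ring
  rw [Pi.smul_apply, E2_eq_tsum_cexp, G2]
  simp only [hexp, bernoulli_two, smul_eq_mul]
  push_cast
  ring

theorem E2_slash_inclSL (γ : SL(2, ℤ)) :
    slash 2 (inclSL γ) E2 = E2 + (6 / (Real.pi * Complex.I)) • lowerRatio (inclSL γ) := by
  ext z
  have hpi : (Real.pi : ℂ) ≠ 0 := Complex.ofReal_ne_zero.2 Real.pi_ne_zero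
  have hD2 : D2 γ z = 2 * Real.pi * Complex.I * lowerRatio (inclSL γ) z := by
    rw [lowerRatio_inclSL, D2]
    ring
  rw [slash_inclSL, Nat.cast_ofNat, E2_slash_action γ]
  simp only [Pi.sub_apply, Pi.add_apply, Pi.smul_apply, smul_eq_mul, hD2, riemannZeta_two]
  field_simp
  linear_combination (-6 * lowerRatio (inclSL γ) z) * Complex.I_sq

/-! ### The discriminant and the cocycle `μ` -/

section Discriminant

variable {f g : ℍ → ℂ}

theorem Delta_eq_smul_discriminant :
    Delta = ((2 * Real.pi) ^ 12 : ℂ) • ModularForm.discriminant := by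
  ext z
  rw [Pi.smul_apply, ModularForm.discriminant_eq_q_prod, Delta, smul_eq_mul,
    tprod_pnat_eq_tprod_succ (f := fun n =>
      (1 - Complex.exp (2 * Real.pi * Complex.I * z) ^ n) ^ 24)]
  simp [Function.Periodic.qParam, ModularForm.eta_q_eq_pow]

theorem Delta_ne_zero (z : ℍ) : Delta z ≠ 0 := by
  rw [Delta_eq_smul_discriminant, Pi.smul_apply, smul_eq_mul]
  have hpi : (Real.pi : ℂ) ≠ 0 := Complex.ofReal_ne_zero.2 Real.pi_ne_zero
  exact mul_ne_zero (pow_ne_zero _ (mul_ne_zero two_ne_zero hpi))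
    (ModularForm.discriminant_ne_zero z)

theorem mdifferentiable_Delta : MDiff Delta := by
  rw [Delta_eq_smul_discriminant]
  exact CuspForm.discriminant.holo'.const_smul _

theorem slash_Delta_ne_zero (m : ℕ) (α : GL(2, ℚ)⁺) (z : ℍ) : slash m α Delta z ≠ 0 := by
  rw [slash_apply]
  exact mul_ne_zero (mul_ne_zero (detFactor_ne_zero _ _) (zpow_ne_zero _ (denom_ne_zero _ z)))
    (Delta_ne_zero _)

theorem D_eq_ddz (f : ℍ → ℂ) (z : ℍ) : D f z = (2 * Real.pi * Complex.I)⁻¹ * ddz f z := rfl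

theorem dlog_eq_D_div (f : ℍ → ℂ) (z : ℍ) :
    dlog f z = 2 * Real.pi * Complex.I * (D f z / f z) := by
  have := Complex.two_pi_I_ne_zero
  rw [D_eq_ddz, dlog]
  field_simp

-- `Δ = (2π)¹² η²⁴`, and the logarithmic derivative of `η` is `(πi/12) E₂`.
theorem D_Delta : D Delta = E2 * Delta := by
  have hdisc : MDiff ModularForm.discriminant := CuspForm.discriminant.holo'
  rw [Delta_eq_smul_discriminant, normalizedDerivOfComplex_smul _ _ hdisc,
    mul_smul_comm]
  congr 1
  ext z
  have hη : DifferentiableAt ℂ ModularForm.eta z :=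
    ModularForm.differentiableAt_eta_of_mem_upperHalfPlaneSet z.2
  have hη_ne : ModularForm.eta z ≠ 0 := ModularForm.eta_ne_zero z.2
  have hlog := ModularForm.logDeriv_eta_eq_E2 z
  rw [logDeriv_apply, div_eq_iff hη_ne] at hlog
  have hpow : ModularForm.discriminant ∘ ofComplex
      =ᶠ[nhds (z : ℂ)] fun w => ModularForm.eta w ^ 24 := by
    filter_upwards [isOpen_upperHalfPlaneSet.mem_nhds z.2] with w hw
    simp [ModularForm.discriminant, ofComplex_apply_of_im_pos hw]
  have := pi_mul_I_ne_zero
  rw [Pi.mul_apply, D_eq_ddz, ddz, hpow.deriv_eq, deriv_fun_pow hη, hlog, ModularForm.discriminant]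
  push_cast
  field_simp
  ring

theorem D_div (hf : MDiff f) (hg : MDiff g) (hg_ne : ∀ z, g z ≠ 0) (z : ℍ) :
    D (fun w => f w / g w) z = (D f z * g z - f z * D g z) / g z ^ 2 := by
  have hcomp : (fun w => f w / g w) ∘ ofComplex
      = fun w => (f ∘ ofComplex) w / (g ∘ ofComplex) w := rfl
  rw [normalizedDerivOfComplex, hcomp, deriv_fun_div (mdifferentiableAt_iff.1 (hf z))
    (mdifferentiableAt_iff.1 (hg z)) (by simpa using hg_ne z)]
  simp only [normalizedDerivOfComplex, Function.comp_apply, ofComplex_apply]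
  ring

theorem D_slash (m : ℕ) (α : GL(2, ℚ)⁺) (hf : MDiff f) :
    D (slash m α f) = slash (m + 2) α (D f) -
      ((m : ℂ) * (2 * Real.pi * Complex.I)⁻¹) • (lowerRatio α * slash m α f) := by
  have hdet : (toGLR α).det.val = (toGLR α).val.det := Matrix.GeneralLinearGroup.val_det_apply _
  have hfactor : detFactor (m + 2) α * ((toGLR α).det.val : ℂ) ^ (1 - ((m + 2 : ℕ) : ℤ))
      = detFactor m α * ((toGLR α).det.val : ℂ) ^ (1 - (m : ℤ))
        * ((toGLR α).det.val : ℂ)⁻¹ := by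
    have hne := ofReal_det_toGLR_ne_zero α
    have hexp : 1 - ((m + 2 : ℕ) : ℤ) = (1 - (m : ℤ)) - 1 - 1 := by push_cast; ring
    rw [detFactor_add, detFactor_two, hexp, zpow_sub_one₀ hne, zpow_sub_one₀ hne]
    field_simp
  rw [slash_eq_smul m, slash_eq_smul (m + 2), hfactor,
    normalizedDerivOfComplex_smul _ _ (hf.slash _ _),
    normalizedDerivOfComplex_slash (k := m) hf (hdet ▸ det_toGLR_pos α)]
  ext z
  simp only [Pi.smul_apply, Pi.sub_apply, Pi.mul_apply, smul_eq_mul, lowerRatio, hdet]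
  push_cast
  ring

theorem mu_eq_smul (α : GL(2, ℚ)⁺) :
    mu α = (1 / 6 : ℂ) • (slash 2 α E2 - (6 / (Real.pi * Complex.I)) • lowerRatio α - E2) := by
  ext z
  have := pi_mul_I_ne_zero
  have := slash_Delta_ne_zero 12 α z
  have := Delta_ne_zero z
  rw [mu, dlog_eq_D_div, D_div (mdifferentiable_slash mdifferentiable_Delta) mdifferentiable_Delta
    Delta_ne_zero, D_slash 12 α mdifferentiable_Delta, D_Delta,
    show 12 + 2 = 2 + 12 from rfl, slash_mul]
  simp only [Pi.smul_apply, Pi.sub_apply, Pi.mul_apply, smul_eq_mul]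
  field_simp
  push_cast
  ring

theorem mu_mul (α β : GL(2, ℚ)⁺) : mu (α * β) = slash 2 β (mu α) + mu β := by
  simp only [mu_eq_smul, lowerRatio_mul, map_smul, map_sub, slash_slash]
  module

theorem mu_inclSL (γ : SL(2, ℤ)) : mu (inclSL γ) = 0 := by
  rw [mu_eq_smul, E2_slash_inclSL]
  simp

theorem mdifferentiable_mu (α : GL(2, ℚ)⁺) : MDiff (mu α) := by
  rw [mu_eq_smul]
  exact (((mdifferentiable_slash E2_mdifferentiable).sub
    ((mdifferentiable_lowerRatio α).const_smul _)).sub E2_mdifferentiable).const_smul _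

-- By the cocycle relation and `μ = 0` on `SL₂(ℤ)` only upper triangular matrices matter.
theorem isBoundedAtImInfty_mu (α : GL(2, ℚ)⁺) : IsBoundedAtImInfty (mu α) := by
  obtain ⟨γ, τ, rfl, hτ⟩ := exists_inclSL_mul_upperTriangular α
  have hslash : IsBoundedAtImInfty (slash 2 τ E2) :=
    isBoundedAtImInfty_slash hτ isBoundedAtImInfty_E2
  have hratio := (isBoundedAtImInfty_lowerRatio τ).smul (6 / (Real.pi * Complex.I))
  rw [mu_mul, mu_inclSL, map_zero, zero_add, mu_eq_smul, sub_eq_add_neg, sub_eq_add_neg]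
  exact ((hslash.add hratio.neg).add isBoundedAtImInfty_E2.neg).smul (1 / 6 : ℂ)

theorem mu_mem_modTower (α : GL(2, ℚ)⁺) : mu α ∈ modTower 2 := by
  have hslash (γ : SL(2, ℤ)) : mu α ∣[((2 : ℕ) : ℤ)] γ = mu (α * inclSL γ) := by
    rw [mu_mul, mu_inclSL, add_zero, slash_inclSL]
  obtain ⟨M, hM, hconj⟩ := exists_Gamma_conj_mem_Gamma α le_rfl
  refine mem_modTower_iff.2 ⟨M, hM, mdifferentiable_mu α, fun γ hγ => ?_, fun γ => ?_⟩
  · obtain ⟨γ', -, h⟩ := hconj γ hγ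
    rw [hslash, h, mu_mul, mu_inclSL, map_zero, zero_add]
  · rw [hslash]
    exact isBoundedAtImInfty_mu _

end Discriminant

/-! ### The Ramanujan operator on the modular tower -/

section Serre

variable {f : ℍ → ℂ}

theorem modX_eq_serreDerivative (m : ℕ) (f : modTower m) :
    modX m f = serreDerivative m (f : ℍ → ℂ) := by
  ext z
  have := pi_mul_I_ne_zero
  have := Delta_ne_zero z
  change 1 / (2 * Real.pi * Complex.I) * ddz f z
    - 1 / (12 * Real.pi * Complex.I) * dlog Delta z * ((m : ℂ) / 2 * (f : ℍ → ℂ) z) = _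
  rw [dlog_eq_D_div, D_Delta, serreDerivative_apply, D_eq_ddz, Pi.mul_apply]
  field_simp

theorem serreDerivative_eq_sub (k : ℂ) (f : ℍ → ℂ) :
    serreDerivative k f = D f - (k / 12) • (E2 * f) := by
  ext z
  simp only [serreDerivative_apply, Pi.sub_apply, Pi.smul_apply, Pi.mul_apply, smul_eq_mul]
  ring

theorem serreDerivative_slash (m : ℕ) (α : GL(2, ℚ)⁺) (hf : MDiff f) :
    serreDerivative m (slash m α f) =
      slash (m + 2) α (serreDerivative m f) + ((m : ℂ) / 2) • (mu α * slash m α f) := by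
  rw [serreDerivative_eq_sub, serreDerivative_eq_sub, map_sub, map_smul, add_comm m 2, slash_mul,
    add_comm 2 m, D_slash m α hf, mu_eq_smul]
  ext z
  have := pi_mul_I_ne_zero
  simp only [Pi.add_apply, Pi.sub_apply, Pi.smul_apply, Pi.mul_apply, smul_eq_mul]
  field_simp
  ring

-- Cauchy's estimate on the circle of radius `1` around `z`.
theorem isBoundedAtImInfty_D (hf : MDiff f) (hb : IsBoundedAtImInfty f) :
    IsBoundedAtImInfty (D f) := by
  obtain ⟨M, A, hM⟩ := isBoundedAtImInfty_iff.1 hb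
  refine isBoundedAtImInfty_iff.2
    ⟨‖(2 * Real.pi * Complex.I)⁻¹‖ * (M / 1), max A 0 + 2, fun z hz => ?_⟩
  have him {w : ℂ} (hw : w ∈ Metric.closedBall (z : ℂ) 1) : A ≤ w.im ∧ 0 < w.im := by
    have hnorm : |(w - z).im| ≤ 1 :=
      (Complex.abs_im_le_norm _).trans (by simpa [dist_eq_norm] using hw)
    have hlow := (abs_le.1 hnorm).1
    rw [Complex.sub_im, coe_im] at hlow
    constructor <;> linarith [le_max_left A 0, le_max_right A 0]
  rw [normalizedDerivOfComplex, norm_mul]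
  refine mul_le_mul_of_nonneg_left
    (Complex.norm_deriv_le_of_forall_mem_sphere_norm_le one_pos ?_ fun w hw => ?_) (norm_nonneg _)
  · refine DifferentiableOn.diffContOnCl ?_
    rw [closure_ball _ one_ne_zero]
    exact (UpperHalfPlane.mdifferentiable_iff.1 hf).mono fun w hw => (him hw).2
  · obtain ⟨hA, hpos⟩ := him (Metric.sphere_subset_closedBall hw)
    rw [Function.comp_apply, ofComplex_apply_of_im_pos hpos]
    exact hM _ hA

theorem isBoundedAtImInfty_serreDerivative (k : ℂ) (hf : MDiff f) (hb : IsBoundedAtImInfty f) :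
    IsBoundedAtImInfty (serreDerivative k f) := by
  rw [serreDerivative_eq_sub, sub_eq_add_neg]
  exact (isBoundedAtImInfty_D hf hb).add ((isBoundedAtImInfty_E2.mul hb).smul (k / 12)).neg

theorem modX_mem_modTower (m : ℕ) (f : modTower m) : modX m f ∈ modTower (m + 2) := by
  obtain ⟨N, hN, hf⟩ := mem_modTower_iff.1 f.2
  rw [modX_eq_serreDerivative, mem_modTower_iff, Nat.cast_add, Nat.cast_ofNat]
  refine ⟨N, hN, serreDerivative_mdifferentiable _ hf.mdifferentiable, fun γ hγ =>
    mod_cast serreDerivative_slash_invariant hf.mdifferentiable (hf.slash_eq γ hγ), fun γ => ?_⟩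
  have hequivariant := serreDerivative_slash_equivariant (k := m) (γ := γ) hf.mdifferentiable
  rw [Int.cast_natCast] at hequivariant
  rw [hequivariant, ModularForm.SL_slash]
  exact isBoundedAtImInfty_serreDerivative _ (hf.mdifferentiable.slash _ _)
    (hf.isBoundedAtImInfty γ)

end Serre

/-! ### Polynomial identities holding at infinitely many points -/

section Polynomial

open Polynomial

theorem sum_filter_eq_zero_of_infinite {ι R : Type*} [CommRing R] [IsDomain R] {s : Finset ι}
    {a : ι → R} {e : ι → ℕ} {A : Set R} (hA : A.Infinite)
    (h : ∀ x ∈ A, ∑ i ∈ s, a i * x ^ e i = 0) (n : ℕ) : ∑ i ∈ s with e i = n, a i = 0 := by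
  have hP : ∑ i ∈ s, C (a i) * X ^ e i = 0 :=
    eq_zero_of_infinite_isRoot _ <| hA.mono fun x hx => by
      simpa [eval_finsetSum] using h x hx
  simpa [coeff_X_pow, Finset.sum_filter, eq_comm] using congrArg (coeff · n) hP

theorem eq_of_sum_pow_eq_sum_sub_pow {R : Type*} [CommRing R] [IsDomain R] {a b : ℕ → R} {c : R}
    {n : ℕ} {A : Set R} (hA : A.Infinite)
    (h : ∀ x ∈ A, ∑ j ∈ Finset.range (n + 1), a j * x ^ j
      = ∑ j ∈ Finset.range (n + 1), b j * (x - c) ^ j) : a n = b n := by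
  have hP : ∑ j ∈ Finset.range (n + 1), C (a j) * X ^ j
      = ∑ j ∈ Finset.range (n + 1), C (b j) * (X - C c) ^ j :=
    eq_of_infinite_eval_eq _ _ <| hA.mono fun x hx => by
      simpa [eval_finsetSum] using h x hx
  have hcoeff (j : ℕ) : ((X - C c) ^ j).coeff n = (-c) ^ (j - n) * j.choose n := by
    rw [sub_eq_add_neg, ← C_neg, coeff_X_add_C_pow]
  have hlower : ∑ j ∈ Finset.range n, b j * ((-c) ^ (j - n) * (j.choose n : R)) = 0 :=
    Finset.sum_eq_zero fun j hj => by
      rw [Nat.choose_eq_zero_of_lt (Finset.mem_range.1 hj), Nat.cast_zero, mul_zero, mul_zero]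
  simpa [Finset.sum_range_succ _ n, coeff_X_pow, hcoeff, hlower] using congrArg (coeff · n) hP

theorem eq_zero_of_sum_mul_pow_mul_add_pow {K : Type*} [Field K] {s : Finset (ℕ × ℕ)}
    {a : ℕ × ℕ → K} {g κ : K} (hκ : κ ≠ 0) {A : Set K} (hA : A.Infinite) {B : K → Set K}
    (hB : ∀ c ∈ A, (B c).Infinite)
    (h : ∀ c ∈ A, ∀ x ∈ B c, ∑ p ∈ s, a p * x ^ (p.1 + p.2) * (g * x + κ * c) ^ p.2 = 0) :
    ∀ p ∈ s, a p = 0 := by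
  have hX (c) (hc : c ∈ A) (x : K) :
      ∑ p ∈ s, a p * x ^ (p.1 + p.2) * (g * x + κ * c) ^ p.2 = 0 := by
    have hP : ∑ p ∈ s, C (a p) * X ^ (p.1 + p.2) * (C g * X + C (κ * c)) ^ p.2 = 0 :=
      eq_zero_of_infinite_isRoot _ <| (hB c hc).mono fun x hx => by
        simpa [eval_finsetSum] using h c hc x hx
    simpa [eval_finsetSum] using congrArg (eval x) hP
  have hU (x : K) (n : ℕ) : ∑ p ∈ s with p.2 = n, a p * x ^ (p.1 + p.2) = 0 := by
    refine sum_filter_eq_zero_of_infinite (A := (fun c => g * x + κ * c) '' A)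
      (hA.image fun c _ c' _ hcc' => mul_left_cancel₀ hκ (add_left_cancel hcc')) ?_ n
    rintro _ ⟨c, hc, rfl⟩
    exact hX c hc x
  intro q hq
  have hq0 := sum_filter_eq_zero_of_infinite hA (fun x _ => hU x q.2) (q.1 + q.2)
  rw [Finset.filter_filter, Finset.sum_eq_single_of_mem q (by simp [hq])] at hq0
  · exact hq0
  · intro p hp hpq
    have := (Finset.mem_filter.1 hp).2
    exact absurd (Prod.ext (by omega) this.1) hpq

end Polynomial

/-! ### Algebraic independence of `G₂` -/

section Independence

variable {N : ℕ} (γ δ : SL(2, ℤ)) (z : ℍ)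

theorem SL_slash_eq_denom_mul (f : ℍ → ℂ) (k : ℤ) :
    (f ∣[k] γ) z = denom γ z ^ (-k) * f (γ • z) := by
  rw [ModularForm.SL_slash_apply, mul_comm]

theorem IsModular.apply_smul {m : ℕ} {f : ℍ → ℂ} (hf : IsModular N m f) {γ : SL(2, ℤ)}
    (hγ : γ ∈ Γ(N)) : f (γ • z) = denom γ z ^ m * f z := by
  have h := congrFun (hf.slash_eq γ hγ) z
  rwa [SL_slash_eq_denom_mul, zpow_neg, zpow_natCast,
    inv_mul_eq_iff_eq_mul₀ (pow_ne_zero _ (denom_ne_zero _ z))] at h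

/-- The constant `κ` in `(cz + d)⁻² G₂(γz) = G₂(z) + κ c / (cz + d)`. -/
def kappa : ℂ := -1 / (4 * (Real.pi * Complex.I))

theorem kappa_ne_zero : kappa ≠ 0 :=
  div_ne_zero (by norm_num) (mul_ne_zero (by norm_num) pi_mul_I_ne_zero)

theorem G2_slash : G2 ∣[(2 : ℤ)] γ = G2 + kappa • lowerRatio (inclSL γ) := by
  have hE2 : E2 ∣[(2 : ℤ)] γ = E2 + (6 / (Real.pi * Complex.I)) • lowerRatio (inclSL γ) := by
    rw [← E2_slash_inclSL, slash_inclSL, Nat.cast_ofNat]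
  rw [G2_eq_smul_E2, ModularForm.SL_smul_slash, hE2, smul_add, smul_smul, kappa]
  have := pi_mul_I_ne_zero
  congr 2
  field_simp
  norm_num

theorem G2_smul : G2 (γ • z) = denom γ z * (denom γ z * G2 z + kappa * γ 1 0) := by
  have h := congrFun (G2_slash γ) z
  have hden : denom γ z ≠ 0 := denom_ne_zero _ z
  rw [SL_slash_eq_denom_mul, zpow_neg, zpow_ofNat, inv_mul_eq_iff_eq_mul₀ (pow_ne_zero _ hden),
    Pi.add_apply, Pi.smul_apply, smul_eq_mul, lowerRatio_inclSL] at h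
  rw [h]
  field_simp

theorem mdifferentiable_G2 : MDiff G2 := by
  rw [G2_eq_smul_E2]
  exact E2_mdifferentiable.const_smul _

theorem isBoundedAtImInfty_G2 : IsBoundedAtImInfty G2 := by
  rw [G2_eq_smul_E2]
  exact isBoundedAtImInfty_E2.smul _

theorem infinite_image_denom (hN : 1 ≤ N) {c : ℤ} (hc : c ≠ 0) (hNc : (N : ℤ) ∣ c) :
    ((fun γ : SL(2, ℤ) => denom γ z) '' {γ ∈ Γ(N) | γ 1 0 = c}).Infinite := by
  let γ (n : ℕ) : SL(2, ℤ) := ⟨!![1, n * N; c, 1 + c * (n * N)], by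
    rw [Matrix.det_fin_two_of]; ring⟩
  have hγ (n : ℕ) : γ n ∈ Γ(N) := by
    have hcN : (c : ZMod N) = 0 := (ZMod.intCast_zmod_eq_zero_iff_dvd c N).2 hNc
    rw [Gamma_mem]
    simp [γ, hcN]
  have hden (n : ℕ) : denom (γ n) z = c * z + 1 + c * (n * N) := by
    rw [ModularGroup.denom_apply]
    simp [γ, add_assoc]
  have hN0 : (N : ℂ) ≠ 0 := Nat.cast_ne_zero.2 (by omega)
  have hc0 : (c : ℂ) ≠ 0 := Int.cast_ne_zero.2 hc
  refine Set.infinite_of_injective_forall_mem (f := fun n => denom (γ n) z) (fun m n hmn => ?_)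
    fun n => ⟨γ n, ⟨hγ n, rfl⟩, rfl⟩
  simp only [hden] at hmn
  exact_mod_cast mul_right_cancel₀ hN0 (mul_left_cancel₀ hc0 (add_left_cancel hmn))

theorem infinite_image_lowerRatio (hN : 1 ≤ N) :
    ((fun γ : SL(2, ℤ) => lowerRatio (inclSL γ) z) '' Γ(N)).Infinite := by
  have hN0 : (N : ℂ) ≠ 0 := Nat.cast_ne_zero.2 (by omega)
  have hinf := infinite_image_denom z hN (c := N) (by exact_mod_cast hN0) dvd_rfl
  refine (hinf.image (f := ((N : ℂ) / ·)) (fun x _ y _ hxy => by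
    simpa [div_eq_mul_inv, hN0] using hxy)).mono ?_
  rintro _ ⟨_, ⟨γ, ⟨hγ, hγN⟩, rfl⟩, rfl⟩
  refine ⟨γ, hγ, ?_⟩
  simp only [lowerRatio_inclSL, hγN, Int.cast_natCast]

/-- This contains both the algebraic independence of `G₂` over the modular tower and the linear
independence of modular forms of different weights. -/
theorem eq_zero_of_sum_mul_G2_pow {s : Finset (ℕ × ℕ)} {a : ℕ × ℕ → ℍ → ℂ} (hN : 1 ≤ N)
    (ha : ∀ p ∈ s, IsModular N p.1 (a p)) (h : ∑ p ∈ s, a p * G2 ^ p.2 = 0) :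
    ∀ p ∈ s, a p = 0 := by
  suffices ∀ z, ∀ p ∈ s, a p z = 0 from fun p hp => funext fun z => this z p hp
  intro z
  have hA : (Set.range fun k : ℕ => (((k + 1) * N : ℤ) : ℂ)).Infinite := by
    refine Set.infinite_range_of_injective fun k k' hk => ?_
    have hN0 : (N : ℤ) ≠ 0 := by omega
    have := mul_right_cancel₀ hN0 (Int.cast_injective hk)
    omega
  refine eq_zero_of_sum_mul_pow_mul_add_pow (a := fun p => a p z) (g := G2 z) kappa_ne_zero hA
    (B := fun c => (fun γ : SL(2, ℤ) => denom γ z) '' {γ ∈ Γ(N) | ((γ 1 0 : ℤ) : ℂ) = c}) ?_ ?_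
  · rintro _ ⟨k, rfl⟩
    simpa only [Int.cast_inj] using infinite_image_denom z hN (c := (k + 1) * N)
      (mul_ne_zero (by omega) (by omega)) (dvd_mul_left _ _)
  · rintro c - _ ⟨γ, ⟨hγ, rfl⟩, rfl⟩
    have hγz := congrFun h (γ • z)
    rw [Finset.sum_apply] at hγz
    refine Eq.trans (Finset.sum_congr rfl fun p hp => ?_) hγz
    rw [Pi.mul_apply, Pi.pow_apply, (ha p hp).apply_smul z hγ, G2_smul, mul_pow, pow_add]
    ring

end Independence

section Expand

theorem applyCoeffs_lof (T : ∀ m : ℕ, modTower m →ₗ[ℂ] (ℍ → ℂ)) (p : ℕ × ℕ) (a : modTower p.1) :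
    applyCoeffs T (DirectSum.lof ℂ (ℕ × ℕ) (fun p => modTower p.1) p a) = T p.1 a * G2 ^ p.2 := by
  rw [applyCoeffs, DirectSum.toModule_lof]
  rfl

theorem exists_forall_isModular {ι : Type*} {s : Finset ι} {w : ι → ℕ} {a : ι → ℍ → ℂ}
    (ha : ∀ i ∈ s, a i ∈ modTower (w i)) : ∃ N : ℕ, 1 ≤ N ∧ ∀ i ∈ s, IsModular N (w i) (a i) := by
  classical
  induction s using Finset.induction_on with
  | empty => exact ⟨1, le_rfl, by simp⟩
  | insert j s _ ih =>
    obtain ⟨M, hM, h⟩ := ih fun i hi => ha i (Finset.mem_insert_of_mem hi)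
    obtain ⟨N, hN, hj⟩ := mem_modTower_iff.1 (ha j (Finset.mem_insert_self _ _))
    refine ⟨M * N, Nat.mul_pos hM hN, fun i hi => ?_⟩
    rcases Finset.mem_insert.1 hi with rfl | hi
    · exact hj.of_dvd (dvd_mul_left _ _)
    · exact (h i hi).of_dvd (dvd_mul_right _ _)

theorem ker_expand : LinearMap.ker expand = ⊥ := by
  classical
  refine (Submodule.eq_bot_iff _).2 fun x hx => ?_
  have hsum : ∑ p ∈ DFinsupp.support x, ((x p : modTower p.1) : ℍ → ℂ) * G2 ^ p.2 = 0 := by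
    calc
      _ = ∑ p ∈ DFinsupp.support x, expand (DirectSum.lof ℂ _ _ p (x p)) :=
        Finset.sum_congr rfl fun p _ => (applyCoeffs_lof _ p (x p)).symm
      _ = expand x := by
        rw [← map_sum]
        exact congrArg expand (DirectSum.sum_support_of x)
      _ = 0 := hx
  obtain ⟨N, hN, h⟩ := exists_forall_isModular (s := DFinsupp.support x) (w := Prod.fst)
    (a := fun p => ((x p : modTower p.1) : ℍ → ℂ)) fun p _ => (x p).2
  have hzero := eq_zero_of_sum_mul_G2_pow hN h hsum
  refine DFinsupp.ext fun p => ?_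
  by_cases hp : p ∈ DFinsupp.support x
  · exact Subtype.ext (hzero p hp)
  · simpa using hp

theorem coeffs_expand (x : Coeffs) : coeffs (expand x) = x :=
  LinearMap.leftInverse_apply_of_inj ker_expand x

end Expand

/-! ### The structure theorem for quasimodular forms -/

section StructureTheorem

variable {N s : ℕ} {k : ℤ} {f g a : ℍ → ℂ} {F G : ℕ → ℍ → ℂ}

theorem mul_pow_slash (a g : ℍ → ℂ) (k l : ℤ) (i : ℕ) (γ : SL(2, ℤ)) :
    (a * g ^ i) ∣[k + l * i] γ = (a ∣[k] γ) * (g ∣[l] γ) ^ i := by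
  induction i with
  | zero => simp
  | succ i ih =>
    have hweight : k + l * ((i + 1 : ℕ) : ℤ) = (k + l * i) + l := by push_cast; ring
    rw [pow_succ, ← mul_assoc, hweight, ModularForm.mul_slash_SL2, ih, pow_succ, mul_assoc]

theorem lowerRatio_inclSL_slash (γ δ : SL(2, ℤ)) :
    lowerRatio (inclSL γ) ∣[(2 : ℤ)] δ
      = lowerRatio (inclSL (γ * δ)) - lowerRatio (inclSL δ) := by
  rw [map_mul, lowerRatio_mul, slash_inclSL, Nat.cast_ofNat, add_sub_cancel_right]

/-- `F 0, …, F s` are the components of the quasimodular form `f` of weight `k` and depth at most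
`s` for `Γ(N)`. The values `F j` with `s < j` are irrelevant. -/
structure IsComponents (N : ℕ) (k : ℤ) (s : ℕ) (f : ℍ → ℂ) (F : ℕ → ℍ → ℂ) : Prop where
  mdifferentiable : ∀ j ≤ s, MDiff (F j)
  isBoundedAtImInfty : ∀ j ≤ s, ∀ γ : SL(2, ℤ), IsBoundedAtImInfty (F j ∣[k - 2 * j] γ)
  slash_eq : ∀ γ ∈ Γ(N),
    f ∣[k] γ = ∑ j ∈ Finset.range (s + 1), F j * lowerRatio (inclSL γ) ^ j

namespace IsComponents

theorem zero (N : ℕ) (k : ℤ) (s : ℕ) : IsComponents N k s 0 0 where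
  mdifferentiable _ _ := mdifferentiable_const
  isBoundedAtImInfty j _ γ := by
    rw [Pi.zero_apply, SlashAction.zero_slash]
    exact Filter.const_boundedAtFilter _ 0
  slash_eq γ _ := by simp

theorem sub (hF : IsComponents N k s f F) (hG : IsComponents N k s g G) :
    IsComponents N k s (f - g) (F - G) where
  mdifferentiable j hj := (hF.mdifferentiable j hj).sub (hG.mdifferentiable j hj)
  isBoundedAtImInfty j hj γ := by
    rw [Pi.sub_apply, sub_eq_add_neg (F j), SlashAction.add_slash, SlashAction.neg_slash]
    exact (hF.isBoundedAtImInfty j hj γ).add (hG.isBoundedAtImInfty j hj γ).neg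
  slash_eq γ hγ := by
    rw [sub_eq_add_neg, SlashAction.add_slash, SlashAction.neg_slash, hF.slash_eq γ hγ,
      hG.slash_eq γ hγ, ← sub_eq_add_neg, ← Finset.sum_sub_distrib]
    exact Finset.sum_congr rfl fun j _ => (sub_mul _ _ _).symm

theorem of_top_eq_zero (hF : IsComponents N k (s + 1) f F) (htop : F (s + 1) = 0) :
    IsComponents N k s f F where
  mdifferentiable j hj := hF.mdifferentiable j (by omega)
  isBoundedAtImInfty j hj := hF.isBoundedAtImInfty j (by omega)
  slash_eq γ hγ := by
    rw [hF.slash_eq γ hγ, Finset.sum_range_succ, htop, zero_mul, add_zero]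

theorem eq_zero_component (hF : IsComponents N k 0 f F) : f = F 0 := by
  simpa using hF.slash_eq 1 (one_mem _)

/-- Compute `f|γ = (f|γδ⁻¹)|δ` in two ways: both sides are polynomials in `c / (cz + d)`, which
takes infinitely many values as `γ` varies, so their leading coefficients agree. -/
theorem isModular_top (hN : 1 ≤ N) (hF : IsComponents N k s f F) :
    IsModular N (k - 2 * s) (F s) := by
  refine ⟨hF.mdifferentiable s le_rfl, fun δ hδ => funext fun z => Eq.symm ?_,
    hF.isBoundedAtImInfty s le_rfl⟩
  refine eq_of_sum_pow_eq_sum_sub_pow (a := fun j => F j z)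
    (b := fun j => (F j ∣[k - 2 * j] δ) z) (infinite_image_lowerRatio z hN)
    (c := lowerRatio (inclSL δ) z) ?_
  rintro _ ⟨γ, hγ, rfl⟩
  have hterm (j : ℕ) : (F j * lowerRatio (inclSL (γ * δ⁻¹)) ^ j) ∣[k] δ
      = (F j ∣[k - 2 * j] δ) * (lowerRatio (inclSL γ) - lowerRatio (inclSL δ)) ^ j := by
    have h := mul_pow_slash (F j) (lowerRatio (inclSL (γ * δ⁻¹))) (k - 2 * j) 2 j δ
    rwa [sub_add_cancel, lowerRatio_inclSL_slash, inv_mul_cancel_right] at h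
  have hslash : f ∣[k] γ = (f ∣[k] (γ * δ⁻¹)) ∣[k] δ := by
    rw [← SlashAction.slash_mul, inv_mul_cancel_right]
  rw [hF.slash_eq γ hγ, hF.slash_eq _ (mul_mem hγ (inv_mem hδ)), SlashAction.sum_slash,
    Finset.sum_congr rfl fun j _ => hterm j] at hslash
  simpa only [Finset.sum_apply, Pi.mul_apply, Pi.pow_apply, Pi.sub_apply] using congrFun hslash z

end IsComponents

theorem IsModular.isComponents_mul_G2_pow (ha : IsModular N k a) (i : ℕ) :
    IsComponents N (k + 2 * i) i (a * G2 ^ i)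
      fun j => ((i.choose j : ℂ) * kappa ^ j) • (a * G2 ^ (i - j)) where
  mdifferentiable _ _ := (ha.mdifferentiable.mul (mdifferentiable_G2.pow _)).const_smul _
  isBoundedAtImInfty j hj γ := by
    have hweight : k + 2 * i - 2 * j = k + 2 * ((i - j : ℕ) : ℤ) := by
      push_cast [Nat.cast_sub hj]
      ring
    have hbdd : IsBoundedAtImInfty (G2 + kappa • lowerRatio (inclSL γ)) :=
      isBoundedAtImInfty_G2.add ((isBoundedAtImInfty_lowerRatio _).smul _)
    have hpow (n : ℕ) : IsBoundedAtImInfty ((G2 + kappa • lowerRatio (inclSL γ)) ^ n) := by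
      induction n with
      | zero => exact Filter.const_boundedAtFilter _ 1
      | succ n ih => exact ih.mul hbdd
    rw [ModularForm.SL_smul_slash, hweight, mul_pow_slash, G2_slash]
    exact Filter.BoundedAtFilter.smul _ ((ha.isBoundedAtImInfty γ).mul (hpow _))
  slash_eq γ hγ := by
    rw [mul_pow_slash, ha.slash_eq γ hγ, G2_slash, add_comm, add_pow, Finset.mul_sum]
    refine Finset.sum_congr rfl fun j _ => ?_
    ext z
    simp only [Pi.smul_apply, Pi.mul_apply, Pi.pow_apply, Pi.natCast_apply, smul_eq_mul, mul_pow]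
    ring

/-- The products `a G₂^i` of a modular form `a` and a power of `G₂`. -/
def monomials : Set (ℍ → ℂ) := {f | ∃ m i : ℕ, ∃ a ∈ modTower m, f = a * G2 ^ i}

namespace IsComponents

theorem exists_mem_span_monomials_top_eq (hN : 1 ≤ N) (hF : IsComponents N k s f F) :
    ∃ g ∈ Submodule.span ℂ monomials, ∃ G, IsComponents N k s g G ∧ G s = F s := by
  have htop := hF.isModular_top hN
  rcases lt_or_ge (k - 2 * s) 0 with hneg | hnonneg
  · exact ⟨0, zero_mem _, 0, .zero N k s, (htop.eq_zero_of_neg hN hneg).symm⟩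
  · have hcomp := (htop.smul (kappa ^ s)⁻¹).isComponents_mul_G2_pow s
    rw [sub_add_cancel] at hcomp
    refine ⟨_, Submodule.subset_span ⟨(k - 2 * s).toNat, s, _, mem_modTower_iff.2 ⟨N, hN, ?_⟩, rfl⟩,
      _, hcomp, ?_⟩
    · rw [Int.toNat_of_nonneg hnonneg]
      exact htop.smul _
    · rw [Nat.choose_self, Nat.cast_one, one_mul, Nat.sub_self, pow_zero, mul_one, smul_smul,
        mul_inv_cancel₀ (pow_ne_zero _ kappa_ne_zero), one_smul]

theorem mem_span_monomials (hN : 1 ≤ N) (hF : IsComponents N k s f F) :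
    f ∈ Submodule.span ℂ monomials := by
  induction s generalizing f F with
  | zero =>
    obtain ⟨g, hg, G, hG, htop⟩ := hF.exists_mem_span_monomials_top_eq hN
    rwa [hF.eq_zero_component, ← htop, ← hG.eq_zero_component]
  | succ s ih =>
    obtain ⟨g, hg, G, hG, htop⟩ := hF.exists_mem_span_monomials_top_eq hN
    have hsub : f - g ∈ Submodule.span ℂ monomials :=
      ih ((hF.sub hG).of_top_eq_zero (sub_eq_zero.2 htop.symm))
    simpa using add_mem hsub hg

end IsComponents

theorem isQuasimodular_iff {k : ℕ} : IsQuasimodular N k s f ↔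
    f = 0 ∧ s = 0 ∨ MDiff f ∧ ∃ F, IsComponents N k s f F ∧ F s ≠ 0 := by
  have happly (F : ℕ → ℍ → ℂ) (γ : SL(2, ℤ)) :
      (f ∣[(k : ℤ)] γ = ∑ j ∈ Finset.range (s + 1), F j * lowerRatio (inclSL γ) ^ j) ↔
        ∀ z : ℍ, ((γ 1 0 : ℂ) * z + (γ 1 1 : ℂ)) ^ (-(k : ℤ)) * f (γ • z)
          = ∑ j ∈ Finset.range (s + 1),
            F j z * ((γ 1 0 : ℂ) / ((γ 1 0 : ℂ) * z + (γ 1 1 : ℂ))) ^ j := by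
    simp only [funext_iff, SL_slash_eq_denom_mul, Finset.sum_apply, Pi.mul_apply, Pi.pow_apply,
      lowerRatio_inclSL, ModularGroup.denom_apply]
  refine or_congr_right (and_congr_right fun _ => exists_congr fun F => ?_)
  refine ⟨fun ⟨hreg, htop, h⟩ => ⟨⟨fun j hj => (hreg j hj).1, fun j hj => (hreg j hj).2,
    fun γ hγ => (happly F γ).2 (h γ hγ)⟩, htop⟩, fun ⟨h, htop⟩ => ⟨fun j hj =>
    ⟨h.mdifferentiable j hj, h.isBoundedAtImInfty j hj⟩, htop,
    fun γ hγ => (happly F γ).1 (h.slash_eq γ hγ)⟩⟩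

theorem QM_eq_span_monomials : QM = Submodule.span ℂ monomials := by
  refine le_antisymm (Submodule.span_le.2 ?_) (Submodule.span_le.2 ?_)
  · rintro f ⟨N, k, s, hN, hf⟩
    obtain ⟨rfl, -⟩ | ⟨-, F, hF, -⟩ := isQuasimodular_iff.1 hf
    · exact zero_mem _
    · exact hF.mem_span_monomials hN
  · rintro _ ⟨m, i, a, ha, rfl⟩
    obtain ⟨N, hN, ha⟩ := mem_modTower_iff.1 ha
    refine Submodule.subset_span ?_
    rcases eq_or_ne a 0 with rfl | ha0
    · exact ⟨N, 0, 0, hN, Or.inl ⟨zero_mul _, rfl⟩⟩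
    · refine ⟨N, m + 2 * i, i, hN, isQuasimodular_iff.2 (Or.inr
        ⟨ha.mdifferentiable.mul (mdifferentiable_G2.pow _), _,
          mod_cast ha.isComponents_mul_G2_pow i, ?_⟩)⟩
      rw [Nat.choose_self, Nat.sub_self, pow_zero, mul_one, Nat.cast_one, one_mul]
      exact smul_ne_zero (pow_ne_zero _ kappa_ne_zero) ha0

end StructureTheorem

/-! ### The operators on `𝒬ℳ` -/

section Operators

variable {f g a : ℍ → ℂ} {m : ℕ} (i : ℕ) (α β : GL(2, ℚ)⁺) (γ : SL(2, ℤ))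

theorem mul_G2_pow_mem_QM (ha : a ∈ modTower m) : a * G2 ^ i ∈ QM := by
  rw [QM_eq_span_monomials]
  exact Submodule.subset_span ⟨m, i, a, ha, rfl⟩

theorem modTower_le_QM (m : ℕ) : modTower m ≤ QM := fun a ha => by
  simpa using mul_G2_pow_mem_QM 0 ha

theorem eqOn_QM {S T : (ℍ → ℂ) →ₗ[ℂ] (ℍ → ℂ)}
    (h : ∀ (m i : ℕ) (a : ℍ → ℂ), a ∈ modTower m → S (a * G2 ^ i) = T (a * G2 ^ i))
    (hf : f ∈ QM) : S f = T f := by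
  rw [QM_eq_span_monomials] at hf
  refine LinearMap.eqOn_span (s := monomials) ?_ hf
  rintro _ ⟨m, i, a, ha, rfl⟩
  exact h m i a ha

theorem eqOn_QM₂ {S T : (ℍ → ℂ) →ₗ[ℂ] (ℍ → ℂ) →ₗ[ℂ] (ℍ → ℂ)}
    (h : ∀ (m n i j : ℕ) (a b : ℍ → ℂ), a ∈ modTower m → b ∈ modTower n →
      S (a * G2 ^ i) (b * G2 ^ j) = T (a * G2 ^ i) (b * G2 ^ j))
    (hf : f ∈ QM) (hg : g ∈ QM) : S f g = T f g := by
  refine eqOn_QM (S := S.flip g) (T := T.flip g) (fun m i a ha => ?_) hf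
  simp only [LinearMap.flip_apply]
  exact eqOn_QM (fun n j b hb => h m n i j a b ha hb) hg

theorem map_mem_QM {T : (ℍ → ℂ) →ₗ[ℂ] (ℍ → ℂ)}
    (h : ∀ (m i : ℕ) (a : ℍ → ℂ), a ∈ modTower m → T (a * G2 ^ i) ∈ QM) (hf : f ∈ QM) :
    T f ∈ QM := by
  have hle : Submodule.span ℂ monomials ≤ QM.comap T := by
    rw [Submodule.span_le]
    rintro _ ⟨m, i, a, ha, rfl⟩
    exact h m i a ha
  exact hle (QM_eq_span_monomials ▸ hf)

theorem mul_G2_pow_mul_mul_G2_pow (a b : ℍ → ℂ) (i j : ℕ) :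
    (a * G2 ^ i) * (b * G2 ^ j) = (a * b) * G2 ^ (i + j) := by
  rw [pow_add]
  ring

theorem mul_mem_QM (hf : f ∈ QM) (hg : g ∈ QM) : f * g ∈ QM := by
  refine map_mem_QM (T := LinearMap.mulRight ℂ g) (fun m i a ha => ?_) hf
  refine map_mem_QM (T := LinearMap.mulLeft ℂ (a * G2 ^ i)) (fun n j b hb => ?_) hg
  rw [LinearMap.mulLeft_apply, mul_G2_pow_mul_mul_G2_pow]
  exact mul_G2_pow_mem_QM _ (mul_mem_modTower ha hb)

theorem one_mem_QM : (1 : ℍ → ℂ) ∈ QM := modTower_le_QM 0 one_mem_modTower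

theorem applyCoeffs_coeffs_mul_G2_pow (T : ∀ m : ℕ, modTower m →ₗ[ℂ] (ℍ → ℂ))
    (ha : a ∈ modTower m) : applyCoeffs T (coeffs (a * G2 ^ i)) = T m ⟨a, ha⟩ * G2 ^ i := by
  have hexpand := applyCoeffs_lof (fun m => (modTower m).subtype) (m, i) ⟨a, ha⟩
  have hT := applyCoeffs_lof T (m, i) ⟨a, ha⟩
  rw [← hT, ← coeffs_expand (DirectSum.lof ℂ (ℕ × ℕ) (fun p => modTower p.1) (m, i) ⟨a, ha⟩),
    expand, hexpand]
  rfl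

theorem opX_mul_G2_pow (ha : a ∈ modTower m) :
    opX (a * G2 ^ i) = serreDerivative m a * G2 ^ i := by
  rw [opX, LinearMap.comp_apply, applyCoeffs_coeffs_mul_G2_pow i modX ha, modX_eq_serreDerivative]

theorem opY_mul_G2_pow (ha : a ∈ modTower m) :
    opY (a * G2 ^ i) = ((m : ℂ) / 2) • (a * G2 ^ i) := by
  rw [opY, LinearMap.comp_apply, applyCoeffs_coeffs_mul_G2_pow i modY ha, ← smul_mul_assoc]
  rfl

theorem qslash_mul_G2_pow (ha : a ∈ modTower m) :
    qslash α (a * G2 ^ i) = slash m α a * G2 ^ i := by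
  rw [qslash, LinearMap.comp_apply, applyCoeffs_coeffs_mul_G2_pow i _ ha]
  rfl

theorem serreDerivative_mem_modTower (ha : a ∈ modTower m) :
    serreDerivative m a ∈ modTower (m + 2) := by
  rw [← modX_eq_serreDerivative m ⟨a, ha⟩]
  exact modX_mem_modTower m ⟨a, ha⟩

theorem opY_eq_smul (ha : a ∈ modTower m) : opY a = ((m : ℂ) / 2) • a := by
  simpa using opY_mul_G2_pow 0 ha

theorem qslash_eq_slash (ha : a ∈ modTower m) : qslash α a = slash m α a := by
  simpa using qslash_mul_G2_pow 0 α ha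

theorem opX_mem_QM (hf : f ∈ QM) : opX f ∈ QM :=
  map_mem_QM (fun m i a ha => by
    rw [opX_mul_G2_pow i ha]
    exact mul_G2_pow_mem_QM i (serreDerivative_mem_modTower ha)) hf

theorem opY_mem_QM (hf : f ∈ QM) : opY f ∈ QM :=
  map_mem_QM (fun m i a ha => by
    rw [opY_mul_G2_pow i ha]
    exact QM.smul_mem _ (mul_G2_pow_mem_QM i ha)) hf

theorem qslash_mem_QM (hf : f ∈ QM) : qslash α f ∈ QM :=
  map_mem_QM (fun m i a ha => by
    rw [qslash_mul_G2_pow i α ha]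
    exact mul_G2_pow_mem_QM i (slash_mem_modTower α ha)) hf

theorem qslash_mul (hf : f ∈ QM) (hg : g ∈ QM) :
    qslash α (f * g) = qslash α f * qslash α g := by
  refine eqOn_QM₂ (S := (LinearMap.mul ℂ (ℍ → ℂ)).compr₂ (qslash α))
    (T := (LinearMap.mul ℂ (ℍ → ℂ)).compl₁₂ (qslash α) (qslash α))
    (fun m n i j a b ha hb => ?_) hf hg
  simp only [LinearMap.compr₂_apply, LinearMap.compl₁₂_apply, LinearMap.mul_apply_apply]
  rw [mul_G2_pow_mul_mul_G2_pow, qslash_mul_G2_pow _ _ (mul_mem_modTower ha hb),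
    qslash_mul_G2_pow _ _ ha, qslash_mul_G2_pow _ _ hb, slash_mul, mul_G2_pow_mul_mul_G2_pow]

theorem qslash_qslash (hf : f ∈ QM) : qslash β (qslash α f) = qslash (α * β) f := by
  refine eqOn_QM (S := qslash β ∘ₗ qslash α) (fun m i a ha => ?_) hf
  rw [LinearMap.comp_apply, qslash_mul_G2_pow _ _ ha, qslash_mul_G2_pow _ _ ha,
    qslash_mul_G2_pow _ _ (slash_mem_modTower α ha), slash_slash]

theorem qslash_one (hf : f ∈ QM) : qslash 1 f = f := by
  refine eqOn_QM (T := LinearMap.id) (fun m i a ha => ?_) hf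
  rw [qslash_mul_G2_pow _ _ ha, slash_one, LinearMap.id_apply]

theorem qslash_apply_one : qslash α 1 = 1 := by
  rw [qslash_eq_slash α one_mem_modTower]
  ext z
  simp [slash_apply, detFactor]

theorem leibniz_QM_of_leibniz_mul_G2_pow {T : (ℍ → ℂ) →ₗ[ℂ] (ℍ → ℂ)}
    (h : ∀ (m n i j : ℕ) (a b : ℍ → ℂ), a ∈ modTower m → b ∈ modTower n →
      T (a * b * G2 ^ (i + j))
        = T (a * G2 ^ i) * (b * G2 ^ j) + a * G2 ^ i * T (b * G2 ^ j))
    (hf : f ∈ QM) (hg : g ∈ QM) : T (f * g) = T f * g + f * T g := by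
  refine eqOn_QM₂ (S := (LinearMap.mul ℂ (ℍ → ℂ)).compr₂ T)
    (T := (LinearMap.mul ℂ (ℍ → ℂ)) ∘ₗ T + (LinearMap.mul ℂ (ℍ → ℂ)).compl₂ T)
    (fun m n i j a b ha hb => ?_) hf hg
  have := h m n i j a b ha hb
  rwa [← mul_G2_pow_mul_mul_G2_pow] at this

theorem opX_mul (hf : f ∈ QM) (hg : g ∈ QM) : opX (f * g) = opX f * g + f * opX g := by
  refine leibniz_QM_of_leibniz_mul_G2_pow (fun m n i j a b ha hb => ?_) hf hg
  rw [opX_mul_G2_pow _ (mul_mem_modTower ha hb), opX_mul_G2_pow _ ha, opX_mul_G2_pow _ hb,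
    Nat.cast_add, serreDerivative_mul _ _ _ _ (modTower_mdifferentiable ha)
      (modTower_mdifferentiable hb), mul_G2_pow_mul_mul_G2_pow, mul_G2_pow_mul_mul_G2_pow,
    add_mul]

theorem opY_mul (hf : f ∈ QM) (hg : g ∈ QM) : opY (f * g) = opY f * g + f * opY g := by
  refine leibniz_QM_of_leibniz_mul_G2_pow (fun m n i j a b ha hb => ?_) hf hg
  rw [opY_mul_G2_pow _ (mul_mem_modTower ha hb), opY_mul_G2_pow _ ha, opY_mul_G2_pow _ hb,
    smul_mul_assoc, mul_smul_comm, mul_G2_pow_mul_mul_G2_pow, ← add_smul, Nat.cast_add, add_div]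

theorem opY_opX (hf : f ∈ QM) : opY (opX f) = opX (opY f) + opX f := by
  refine eqOn_QM (S := opY ∘ₗ opX) (T := opX ∘ₗ opY + opX) (fun m i a ha => ?_) hf
  simp only [LinearMap.comp_apply, LinearMap.add_apply]
  rw [opX_mul_G2_pow _ ha, opY_mul_G2_pow _ ha,
    opY_mul_G2_pow _ (serreDerivative_mem_modTower ha), map_smul, opX_mul_G2_pow _ ha,
    Nat.cast_add, add_div, add_smul]
  norm_num

theorem opY_qslash (hf : f ∈ QM) : opY (qslash α f) = qslash α (opY f) := by
  refine eqOn_QM (S := opY ∘ₗ qslash α) (T := qslash α ∘ₗ opY) (fun m i a ha => ?_) hf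
  simp only [LinearMap.comp_apply]
  rw [qslash_mul_G2_pow _ _ ha, opY_mul_G2_pow _ ha,
    opY_mul_G2_pow _ (slash_mem_modTower α ha), map_smul, qslash_mul_G2_pow _ _ ha]

theorem opX_qslash (hf : f ∈ QM) :
    opX (qslash α f) = qslash α (opX f) + mu α * qslash α (opY f) := by
  refine eqOn_QM (S := opX ∘ₗ qslash α)
    (T := qslash α ∘ₗ opX + LinearMap.mulLeft ℂ (mu α) ∘ₗ qslash α ∘ₗ opY)
    (fun m i a ha => ?_) hf
  simp only [LinearMap.comp_apply, LinearMap.add_apply, LinearMap.mulLeft_apply]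
  rw [qslash_mul_G2_pow _ _ ha, opX_mul_G2_pow _ ha,
    opX_mul_G2_pow _ (slash_mem_modTower α ha), opY_mul_G2_pow _ ha, map_smul,
    qslash_mul_G2_pow _ _ ha, qslash_mul_G2_pow _ _ (serreDerivative_mem_modTower ha),
    serreDerivative_slash _ _ (modTower_mdifferentiable ha), add_mul, mul_smul_comm,
    smul_mul_assoc, mul_assoc]

theorem opX_qslash_inclSL (hf : f ∈ QM) :
    opX (qslash (inclSL γ) f) = qslash (inclSL γ) (opX f) := by
  rw [opX_qslash _ hf, mu_inclSL, zero_mul, add_zero]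

theorem opX_one : opX 1 = 0 := by
  have h := opX_mul one_mem_QM one_mem_QM
  rw [mul_one, one_mul, mul_one] at h
  exact left_eq_add.1 h

theorem opY_one : opY 1 = 0 := by
  rw [opY_eq_smul one_mem_modTower]
  simp

/-- The functions `X^n(μ_α)`, so that `δ_{n+1}` acts on `F_α` as multiplication by
`muIter n α`. -/
def muIter (n : ℕ) (α : GL(2, ℚ)⁺) : ℍ → ℂ := (opX ^ n) (mu α)

theorem muIter_zero : muIter 0 α = mu α := rfl

theorem muIter_succ (n : ℕ) : muIter (n + 1) α = opX (muIter n α) := by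
  rw [muIter, pow_succ']
  rfl

theorem muIter_mem_QM (n : ℕ) : muIter n α ∈ QM := by
  induction n with
  | zero => exact modTower_le_QM 2 (mu_mem_modTower α)
  | succ n ih =>
    rw [muIter_succ]
    exact opX_mem_QM ih

theorem mu_mul_eq_qslash_add : mu (α * β) = qslash β (mu α) + mu β := by
  rw [mu_mul, qslash_eq_slash β (mu_mem_modTower α)]

theorem muIter_inclSL_mul (n : ℕ) : muIter n (inclSL γ * α) = muIter n α := by
  rw [muIter, muIter, mu_mul, mu_inclSL, map_zero, zero_add]

theorem muIter_mul_inclSL (n : ℕ) :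
    muIter n (α * inclSL γ) = qslash (inclSL γ) (muIter n α) := by
  induction n with
  | zero => rw [muIter_zero, muIter_zero, mu_mul_eq_qslash_add, mu_inclSL, add_zero]
  | succ n ih => rw [muIter_succ, muIter_succ, ih, opX_qslash_inclSL _ (muIter_mem_QM α n)]

theorem opY_muIter (n : ℕ) : opY (muIter n α) = ((n + 1 : ℕ) : ℂ) • muIter n α := by
  induction n with
  | zero =>
    rw [muIter_zero, opY_eq_smul (mu_mem_modTower α)]
    norm_num
  | succ n ih =>
    rw [muIter_succ, opY_opX (muIter_mem_QM α n), ih, map_smul, Nat.cast_succ (n + 1), add_smul,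
      one_smul]

end Operators

/-! ### Sums over right cosets -/

theorem finsum_finsum_comm {ι κ M : Type*} [AddCommMonoid M] {f : ι → κ → M}
    (hf : f.HasFiniteSupport) (h : ∀ i, (f i).HasFiniteSupport) :
    ∑ᶠ i, ∑ᶠ k, f i k = ∑ᶠ k, ∑ᶠ i, f i k := by
  have hfin : f.support.Finite := hf
  have hsum : ∀ k, ∑ᶠ i, f i k = ∑ i ∈ hfin.toFinset, f i k := fun k =>
    finsum_eq_sum_of_support_subset _ fun i hi => by
      rw [Set.Finite.coe_toFinset]
      exact fun h0 => hi (congrFun h0 k)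
  rw [finsum_congr hsum, finsum_sum_comm _ _ fun i _ => h i]
  refine finsum_eq_sum_of_support_subset _ fun i hi => ?_
  rw [Set.Finite.coe_toFinset]
  refine fun h0 => hi ?_
  simp only [h0, Pi.zero_apply, finsum_zero]

section RightCosets

variable {H M : Type*} [Group H] {Γ : Subgroup H} {φ : H → M}

/-- The set `Γ \ H` of right cosets. -/
abbrev RightCosets (Γ : Subgroup H) : Type _ := Quotient (QuotientGroup.rightRel Γ)

theorem rightCosets_mk_eq_mk {a b : H} :
    (⟦a⟧ : RightCosets Γ) = ⟦b⟧ ↔ b * a⁻¹ ∈ Γ :=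
  Quotient.eq.trans QuotientGroup.rightRel_apply

theorem apply_out_mk (hφ : ∀ γ ∈ Γ, ∀ h, φ (γ * h) = φ h) (h : H) :
    φ (⟦h⟧ : RightCosets Γ).out = φ h := by
  have hmem : h * (⟦h⟧ : RightCosets Γ).out⁻¹ ∈ Γ :=
    rightCosets_mk_eq_mk.1 (Quotient.out_eq _)
  simpa using (hφ _ hmem (⟦h⟧ : RightCosets Γ).out).symm

/-- Right multiplication by `h`, as a permutation of `Γ \ H`. -/
def cosetMulRight (Γ : Subgroup H) (h : H) : RightCosets Γ ≃ RightCosets Γ :=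
  Quotient.congr (Equiv.mulRight h) fun a b => by
    change (QuotientGroup.rightRel Γ) a b ↔ (QuotientGroup.rightRel Γ) (a * h) (b * h)
    simp [QuotientGroup.rightRel_apply, mul_assoc]

theorem cosetMulRight_mk (h a : H) : cosetMulRight Γ h ⟦a⟧ = ⟦a * h⟧ := rfl

theorem apply_out_cosetMulRight (hφ : ∀ γ ∈ Γ, ∀ h, φ (γ * h) = φ h) (h : H)
    (q : RightCosets Γ) : φ (cosetMulRight Γ h q).out = φ (q.out * h) := by
  conv_lhs => rw [← Quotient.out_eq q, cosetMulRight_mk, apply_out_mk hφ]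

theorem finsum_out_mul_right [AddCommMonoid M] (hφ : ∀ γ ∈ Γ, ∀ h, φ (γ * h) = φ h) (h : H) :
    ∑ᶠ q : RightCosets Γ, φ (q.out * h) = ∑ᶠ q : RightCosets Γ, φ q.out := by
  rw [← finsum_comp_equiv (cosetMulRight Γ h) (f := fun q => φ q.out)]
  exact finsum_congr fun q => (apply_out_cosetMulRight hφ h q).symm

theorem hasFiniteSupport_out_of_mul_right [Zero M] (hφ : ∀ γ ∈ Γ, ∀ h, φ (γ * h) = φ h) (h : H)
    (hf : (fun q : RightCosets Γ => φ (q.out * h)).HasFiniteSupport) :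
    (fun q : RightCosets Γ => φ q.out).HasFiniteSupport := by
  refine (hf.image (cosetMulRight Γ h)).subset fun q hq => ?_
  refine ⟨(cosetMulRight Γ h).symm q, ?_, Equiv.apply_symm_apply _ q⟩
  rwa [Function.mem_support, ← apply_out_cosetMulRight hφ, Equiv.apply_symm_apply]

end RightCosets

/-! ### Translates of functions on `GL₂⁺(ℚ)` -/

section Translate

variable {N : ℕ} {α β γ : GL(2, ℚ)⁺} {F : GL(2, ℚ)⁺ → ℍ → ℂ}

/-- The translate `α ↦ F_{αβ⁻¹}‖β`. Both Hecke products are sums of the functions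
`F_β · (translate β G)`, and right equivariance says that a Hecke operator equals its translates by
`Γ(N)`. -/
def translate (β : GL(2, ℚ)⁺) : (GL(2, ℚ)⁺ → ℍ → ℂ) →ₗ[ℂ] (GL(2, ℚ)⁺ → ℍ → ℂ) :=
  LinearMap.pi fun α => qslash β ∘ₗ LinearMap.proj (α * β⁻¹)

theorem translate_apply (F : GL(2, ℚ)⁺ → ℍ → ℂ) (α β : GL(2, ℚ)⁺) :
    translate β F α = qslash β (F (α * β⁻¹)) := rfl

theorem translate_apply_mul (F : GL(2, ℚ)⁺ → ℍ → ℂ) (α β : GL(2, ℚ)⁺) :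
    translate β F (α * β) = qslash β (F α) := by
  rw [translate_apply, mul_inv_cancel_right]

theorem translate_translate (hF : ∀ α, F α ∈ QM) (α β : GL(2, ℚ)⁺) :
    translate β (translate α F) = translate (α * β) F := by
  funext δ
  simp only [translate_apply]
  rw [qslash_qslash _ _ (hF _), mul_inv_rev, mul_assoc]

theorem translate_one (hF : ∀ α, F α ∈ QM) : translate 1 F = F := by
  funext δ
  rw [translate_apply, inv_one, mul_one, qslash_one (hF _)]

theorem translate_mem_QM (hF : ∀ α, F α ∈ QM) (α β : GL(2, ℚ)⁺) : translate β F α ∈ QM :=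
  qslash_mem_QM β (hF _)

namespace QHecke

variable (F : QHecke N)

theorem apply_mem_QM (α : GL(2, ℚ)⁺) : F.1 α ∈ QM := F.2.1 α

theorem apply_mul_left (hγ : γ ∈ GammaQ N) (α : GL(2, ℚ)⁺) : F.1 (γ * α) = F.1 α :=
  F.2.2.1 γ hγ α

theorem finite_cosets_support :
    ((fun α => (⟦α⟧ : Cosets N)) '' {α | F.1 α ≠ 0}).Finite := F.2.2.2.1

theorem apply_mul_right (hγ : γ ∈ GammaQ N) (α : GL(2, ℚ)⁺) :
    F.1 (α * γ) = qslash γ (F.1 α) := F.2.2.2.2 γ hγ α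

theorem translate_eq (hγ : γ ∈ GammaQ N) : translate γ F.1 = F.1 := by
  funext α
  rw [translate_apply, ← QHecke.apply_mul_right F hγ, inv_mul_cancel_right]

theorem translate_mul_left (hγ : γ ∈ GammaQ N) (α β : GL(2, ℚ)⁺) :
    translate β F.1 (γ * α) = translate β F.1 α := by
  rw [translate_apply, translate_apply, mul_assoc, QHecke.apply_mul_left F hγ]

end QHecke

end Translate

/-! ### The Hecke products -/

theorem exists_inclSL_eq_of_mem_GammaQ {N : ℕ} {γ : GL(2, ℚ)⁺} (h : γ ∈ GammaQ N) :
    ∃ δ, inclSL δ = γ := by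
  obtain ⟨δ, -, rfl⟩ := h
  exact ⟨δ, rfl⟩

theorem inclSL_injective : Function.Injective inclSL := by
  intro γ δ h
  ext i j
  simpa [inclSL] using congrArg (fun α : GL(2, ℚ)⁺ => (α : GL (Fin 2) ℚ) i j) h

/-- `ι : H → GL₂⁺(ℚ)` is injective and maps `Γ ≤ H` onto `Γ(N)`. The sums over `Γ \ H` with
`H = GL₂⁺(ℚ)` and `H = SL₂(ℤ)` are the products `∗` and `∗ʳ`. -/
structure IsLevel (N : ℕ) {H : Type*} [Group H] (ι : H →* GL(2, ℚ)⁺) (Γ : Subgroup H) :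
    Prop where
  injective : Function.Injective ι
  map_eq : Γ.map ι = GammaQ N

theorem isLevel_id (N : ℕ) : IsLevel N (MonoidHom.id _) (GammaQ N) :=
  ⟨Function.injective_id, Subgroup.map_id _⟩

theorem isLevel_inclSL (N : ℕ) : IsLevel N inclSL Γ(N) := ⟨inclSL_injective, rfl⟩

section Product

variable {N : ℕ} {H : Type*} [Group H] {ι : H →* GL(2, ℚ)⁺} {Γ : Subgroup H}

theorem IsLevel.map_mem (hι : IsLevel N ι Γ) {γ : H} (hγ : γ ∈ Γ) : ι γ ∈ GammaQ N :=
  hι.map_eq ▸ Subgroup.mem_map_of_mem ι hγ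

theorem IsLevel.rightCosets_mk_injective (hι : IsLevel N ι Γ) :
    Function.Injective fun q : RightCosets Γ => (⟦ι q.out⟧ : Cosets N) := by
  intro q q' h
  have hmem := rightCosets_mk_eq_mk.1 h
  rw [← hι.map_eq, ← map_inv, ← map_mul, Subgroup.mem_map_iff_mem hι.injective] at hmem
  rw [← Quotient.out_eq q, ← Quotient.out_eq q']
  exact rightCosets_mk_eq_mk.2 hmem

/-- The summand `F_β · (G_{αβ⁻¹}‖β)` of a Hecke product. -/
def heckeTerm (ι : H →* GL(2, ℚ)⁺) (F G : GL(2, ℚ)⁺ → ℍ → ℂ) (α : GL(2, ℚ)⁺) (h : H) : ℍ → ℂ :=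
  F (ι h) * translate (ι h) G α

/-- The product `∑_{β ∈ Γ \ H} F_β · (G_{αβ⁻¹}‖β)`. -/
def cosetMul (ι : H →* GL(2, ℚ)⁺) (Γ : Subgroup H) (F G : GL(2, ℚ)⁺ → ℍ → ℂ)
    (α : GL(2, ℚ)⁺) : ℍ → ℂ :=
  ∑ᶠ β : RightCosets Γ, heckeTerm ι F G α β.out

theorem QHecke.hasFiniteSupport (hι : IsLevel N ι Γ) (F : QHecke N) :
    (fun q : RightCosets Γ => F.1 (ι q.out)).HasFiniteSupport := by
  refine Set.Finite.of_finite_image ((QHecke.finite_cosets_support F).subset ?_)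
    hι.rightCosets_mk_injective.injOn
  rintro _ ⟨q, hq, rfl⟩
  exact ⟨ι q.out, hq, rfl⟩

theorem QHecke.hasFiniteSupport_translate (hι : IsLevel N ι Γ) (F : QHecke N) (δ : H) :
    (fun q : RightCosets Γ => translate (ι δ) F.1 (ι q.out)).HasFiniteSupport := by
  refine hasFiniteSupport_out_of_mul_right (φ := fun h => translate (ι δ) F.1 (ι h))
    (fun γ hγ h => ?_) δ ?_
  · rw [map_mul, QHecke.translate_mul_left F (hι.map_mem hγ)]
  · simp only [map_mul, translate_apply_mul]
    exact (QHecke.hasFiniteSupport hι F).fun_comp (map_zero (qslash (ι δ)))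

theorem hasFiniteSupport_heckeTerm {F : GL(2, ℚ)⁺ → ℍ → ℂ}
    (hF : (fun q : RightCosets Γ => F (ι q.out)).HasFiniteSupport) (G : GL(2, ℚ)⁺ → ℍ → ℂ)
    (α : GL(2, ℚ)⁺) : (fun q : RightCosets Γ => heckeTerm ι F G α q.out).HasFiniteSupport :=
  hF.mul_left fun q => translate (ι q.out) G α

theorem heckeTerm_mul_left (hι : IsLevel N ι Γ) {F : GL(2, ℚ)⁺ → ℍ → ℂ}
    (hF : ∀ γ ∈ GammaQ N, ∀ β, F (γ * β) = F β) (G : QHecke N) (α : GL(2, ℚ)⁺) {γ : H}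
    (hγ : γ ∈ Γ) (h : H) : heckeTerm ι F G.1 α (γ * h) = heckeTerm ι F G.1 α h := by
  rw [heckeTerm, heckeTerm, map_mul, hF _ (hι.map_mem hγ),
    ← translate_translate (QHecke.apply_mem_QM G), QHecke.translate_eq G (hι.map_mem hγ)]

theorem heckeTerm_mem_QM (F G : QHecke N) (α : GL(2, ℚ)⁺) (h : H) :
    heckeTerm ι F.1 G.1 α h ∈ QM :=
  mul_mem_QM (QHecke.apply_mem_QM F _) (translate_mem_QM (QHecke.apply_mem_QM G) _ _)

theorem qslash_heckeTerm (F G : QHecke N) (α : GL(2, ℚ)⁺) (δ h : H) :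
    qslash (ι δ) (heckeTerm ι F.1 G.1 (α * (ι δ)⁻¹) h)
      = heckeTerm ι (translate (ι δ) F.1) G.1 α (h * δ) := by
  rw [heckeTerm, heckeTerm, qslash_mul _ (QHecke.apply_mem_QM F _)
      (translate_mem_QM (QHecke.apply_mem_QM G) _ _), map_mul, translate_apply_mul,
    ← translate_translate (QHecke.apply_mem_QM G),
    translate_apply (translate (ι h) G.1)]

theorem translate_cosetMul (hι : IsLevel N ι Γ) (F G : QHecke N) (δ : H) :
    translate (ι δ) (cosetMul ι Γ F.1 G.1) = cosetMul ι Γ (translate (ι δ) F.1) G.1 := by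
  funext α
  have hinv := fun γ (hγ : γ ∈ Γ) => heckeTerm_mul_left hι
    (fun γ hγ β => QHecke.translate_mul_left F hγ β (ι δ)) G α hγ
  rw [translate_apply, cosetMul, cosetMul, ← finsum_out_mul_right hinv δ,
    map_finsum _ (hasFiniteSupport_heckeTerm (QHecke.hasFiniteSupport hι F) _ _)]
  exact finsum_congr fun q => qslash_heckeTerm F G α δ q.out

theorem cosetMul_mem_QM (F G : QHecke N) (α : GL(2, ℚ)⁺) : cosetMul ι Γ F.1 G.1 α ∈ QM :=
  finsum_induction (· ∈ QM) QM.zero_mem (fun _ _ => QM.add_mem) fun _ => heckeTerm_mem_QM F G α _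

theorem cosetMul_mul_left (F G : QHecke N) {γ : GL(2, ℚ)⁺} (hγ : γ ∈ GammaQ N)
    (α : GL(2, ℚ)⁺) : cosetMul ι Γ F.1 G.1 (γ * α) = cosetMul ι Γ F.1 G.1 α :=
  finsum_congr fun q => by rw [heckeTerm, heckeTerm, QHecke.translate_mul_left G hγ]

theorem cosetMul_mul_right (hι : IsLevel N ι Γ) (F G : QHecke N) {γ : GL(2, ℚ)⁺}
    (hγ : γ ∈ GammaQ N) (α : GL(2, ℚ)⁺) :
    cosetMul ι Γ F.1 G.1 (α * γ) = qslash γ (cosetMul ι Γ F.1 G.1 α) := by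
  obtain ⟨δ, hδ, rfl⟩ := hι.map_eq.symm ▸ hγ
  rw [← translate_apply_mul, translate_cosetMul hι, QHecke.translate_eq F (hι.map_mem hδ)]

theorem finite_cosets_support_cosetMul (hι : IsLevel N ι Γ) (F G : QHecke N) :
    ((fun α => (⟦α⟧ : Cosets N)) '' {α | cosetMul ι Γ F.1 G.1 α ≠ 0}).Finite := by
  refine ((QHecke.hasFiniteSupport hι F).biUnion fun q _ =>
    (QHecke.finite_cosets_support G).image (cosetMulRight (GammaQ N) (ι q.out))).subset ?_
  rintro _ ⟨α, hα, rfl⟩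
  obtain ⟨q, hq⟩ : ∃ q : RightCosets Γ, heckeTerm ι F.1 G.1 α q.out ≠ 0 := by
    by_contra! h
    exact hα (finsum_eq_zero_of_forall_eq_zero h)
  have hGq : G.1 (α * (ι q.out)⁻¹) ≠ 0 := fun h =>
    right_ne_zero_of_mul hq (by rw [translate_apply, h, map_zero])
  refine Set.mem_biUnion (left_ne_zero_of_mul hq) ⟨⟦α * (ι q.out)⁻¹⟧, ⟨_, hGq, rfl⟩, ?_⟩
  rw [cosetMulRight_mk, inv_mul_cancel_right]

section Bilinear

variable {F F' : GL(2, ℚ)⁺ → ℍ → ℂ} (hF : (fun q : RightCosets Γ => F (ι q.out)).HasFiniteSupport)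

include hF

theorem add_cosetMul (hF' : (fun q : RightCosets Γ => F' (ι q.out)).HasFiniteSupport)
    (G : GL(2, ℚ)⁺ → ℍ → ℂ) :
    cosetMul ι Γ (F + F') G = cosetMul ι Γ F G + cosetMul ι Γ F' G := by
  funext α
  rw [Pi.add_apply, cosetMul, cosetMul, cosetMul, ← finsum_add_distrib
    (hasFiniteSupport_heckeTerm hF G α) (hasFiniteSupport_heckeTerm hF' G α)]
  exact finsum_congr fun q => add_mul _ _ _

theorem smul_cosetMul (c : ℂ) (G : GL(2, ℚ)⁺ → ℍ → ℂ) :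
    cosetMul ι Γ (c • F) G = c • cosetMul ι Γ F G := by
  funext α
  rw [Pi.smul_apply, cosetMul, cosetMul, smul_finsum' _ (hasFiniteSupport_heckeTerm hF G α)]
  exact finsum_congr fun q => smul_mul_assoc c (F (ι q.out)) _

theorem cosetMul_add (G G' : GL(2, ℚ)⁺ → ℍ → ℂ) :
    cosetMul ι Γ F (G + G') = cosetMul ι Γ F G + cosetMul ι Γ F G' := by
  funext α
  rw [Pi.add_apply, cosetMul, cosetMul, cosetMul, ← finsum_add_distrib
    (hasFiniteSupport_heckeTerm hF G α) (hasFiniteSupport_heckeTerm hF G' α)]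
  exact finsum_congr fun q => by rw [heckeTerm, map_add, Pi.add_apply, mul_add]; rfl

theorem cosetMul_smul (c : ℂ) (G : GL(2, ℚ)⁺ → ℍ → ℂ) :
    cosetMul ι Γ F (c • G) = c • cosetMul ι Γ F G := by
  funext α
  rw [Pi.smul_apply, cosetMul, cosetMul, smul_finsum' _ (hasFiniteSupport_heckeTerm hF G α)]
  exact finsum_congr fun q => by rw [heckeTerm, map_smul, Pi.smul_apply, mul_smul_comm]; rfl

end Bilinear

/-- The Hecke product over `Γ \ H` as a bilinear map. -/
def cosetMulHom (hι : IsLevel N ι Γ) : QHecke N →ₗ[ℂ] QHecke N →ₗ[ℂ] QHecke N :=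
  LinearMap.mk₂ ℂ
    (fun F G => ⟨cosetMul ι Γ F.1 G.1, cosetMul_mem_QM F G,
      fun _ => cosetMul_mul_left F G, finite_cosets_support_cosetMul hι F G,
      fun _ => cosetMul_mul_right hι F G⟩)
    (fun F F' G => Subtype.ext <|
      add_cosetMul (QHecke.hasFiniteSupport hι F) (QHecke.hasFiniteSupport hι F') G.1)
    (fun c F G => Subtype.ext <| smul_cosetMul (QHecke.hasFiniteSupport hι F) c G.1)
    (fun F G G' => Subtype.ext <| cosetMul_add (QHecke.hasFiniteSupport hι F) G.1 G'.1)
    (fun c F G => Subtype.ext <| cosetMul_smul (QHecke.hasFiniteSupport hι F) c G.1)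

theorem cosetMulHom_apply (hι : IsLevel N ι Γ) (F G : QHecke N) :
    (cosetMulHom hι F G).1 = cosetMul ι Γ F.1 G.1 := rfl

theorem heckeTerm_cosetMul_right (hι : IsLevel N ι Γ) (F : GL(2, ℚ)⁺ → ℍ → ℂ) (G K : QHecke N)
    (α : GL(2, ℚ)⁺) (h : H) : heckeTerm ι F (cosetMul ι Γ G.1 K.1) α h
      = ∑ᶠ q : RightCosets Γ, F (ι h) * heckeTerm ι (translate (ι h) G.1) K.1 α q.out := by
  rw [heckeTerm, translate_cosetMul hι, cosetMul,
    mul_finsum' _ _ (hasFiniteSupport_heckeTerm (QHecke.hasFiniteSupport_translate hι G h) _ _)]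

theorem heckeTerm_cosetMul_left (hι : IsLevel N ι Γ) (F : QHecke N) (G K : GL(2, ℚ)⁺ → ℍ → ℂ)
    (α : GL(2, ℚ)⁺) (h : H) : heckeTerm ι (cosetMul ι Γ F.1 G) K α h
      = ∑ᶠ q : RightCosets Γ,
        F.1 (ι q.out) * heckeTerm ι (translate (ι q.out) G) K α h := by
  rw [heckeTerm, cosetMul,
    finsum_mul' _ _ (hasFiniteSupport_heckeTerm (QHecke.hasFiniteSupport hι F) _ _)]
  exact finsum_congr fun q => mul_assoc _ _ _

theorem cosetMulHom_assoc (hι : IsLevel N ι Γ) (F G K : QHecke N) :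
    cosetMulHom hι (cosetMulHom hι F G) K = cosetMulHom hι F (cosetMulHom hι G K) := by
  refine Subtype.ext (funext fun α => ?_)
  simp only [cosetMulHom_apply]
  rw [cosetMul, cosetMul, finsum_congr fun p => heckeTerm_cosetMul_left hι F G.1 K.1 α _,
    finsum_congr fun q => heckeTerm_cosetMul_right hι F.1 G K α _]
  refine (finsum_finsum_comm ((QHecke.hasFiniteSupport hι F).subset
    fun q hq (hFq : F.1 (ι q.out) = 0) => hq ?_) fun q => ?_).symm
  · funext p
    rw [hFq, zero_mul, Pi.zero_apply]
  · exact (hasFiniteSupport_heckeTerm (QHecke.hasFiniteSupport_translate hι G q.out) K.1 α).fun_comp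
      (mul_zero (F.1 (ι q.out)))

end Product

section Unit

variable {N : ℕ} {α : GL(2, ℚ)⁺}

open Classical in
/-- The unit of the product `∗`: the indicator function of `Γ(N)`. -/
def heckeOne (N : ℕ) : QHecke N where
  val α := if α ∈ GammaQ N then 1 else 0
  property := by
    refine ⟨fun α => ?_, fun γ hγ α => ?_, ?_, fun γ hγ α => ?_⟩
    · dsimp only
      split_ifs
      exacts [one_mem_QM, QM.zero_mem]
    · simp only [Subgroup.mul_mem_cancel_left _ hγ]
    · refine (Set.finite_singleton (⟦1⟧ : Cosets N)).subset ?_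
      rintro _ ⟨α, hα, rfl⟩
      refine rightCosets_mk_eq_mk.2 ?_
      rw [one_mul]
      exact inv_mem (by_contra fun h => hα (if_neg h))
    · simp only [Subgroup.mul_mem_cancel_right _ hγ]
      split_ifs
      exacts [(qslash_apply_one γ).symm, (map_zero _).symm]

theorem heckeOne_of_mem (h : α ∈ GammaQ N) : (heckeOne N).1 α = 1 := if_pos h

theorem heckeOne_of_notMem (h : α ∉ GammaQ N) : (heckeOne N).1 α = 0 := if_neg h

theorem heckeOne_mul (F : QHecke N) : cosetMulHom (isLevel_id N) (heckeOne N) F = F := by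
  have hinv := fun α γ (hγ : γ ∈ GammaQ N) =>
    heckeTerm_mul_left (isLevel_id N) (fun _ hγ => QHecke.apply_mul_left (heckeOne N) hγ) F α hγ
  refine Subtype.ext (funext fun α => ?_)
  rw [cosetMulHom_apply, cosetMul, finsum_eq_single _ ⟦1⟧ fun q hq => ?_, apply_out_mk (hinv α),
    heckeTerm, map_one, heckeOne_of_mem (one_mem _), one_mul, translate_one (QHecke.apply_mem_QM F)]
  have hq' : q.out ∉ GammaQ N := fun h => hq <| by
    rw [← Quotient.out_eq q, rightCosets_mk_eq_mk, one_mul]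
    exact inv_mem h
  rw [heckeTerm, MonoidHom.id_apply, heckeOne_of_notMem hq', zero_mul]

theorem mul_heckeOne (F : QHecke N) : cosetMulHom (isLevel_id N) F (heckeOne N) = F := by
  have hinv := fun α γ (hγ : γ ∈ GammaQ N) =>
    heckeTerm_mul_left (isLevel_id N) (fun _ hγ => QHecke.apply_mul_left F hγ) (heckeOne N) α hγ
  refine Subtype.ext (funext fun α => ?_)
  rw [cosetMulHom_apply, cosetMul, finsum_eq_single _ ⟦α⟧ fun q hq => ?_, apply_out_mk (hinv α),
    heckeTerm, MonoidHom.id_apply, translate_apply, mul_inv_cancel, heckeOne_of_mem (one_mem _),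
    qslash_apply_one, mul_one]
  have hq' : α * q.out⁻¹ ∉ GammaQ N := fun h => hq <| by
    rwa [← Quotient.out_eq q, rightCosets_mk_eq_mk]
  rw [heckeTerm, MonoidHom.id_apply, translate_apply, heckeOne_of_notMem hq', map_zero, mul_zero]

end Unit

/-! ### Actions compatible with the coproduct -/

section TensorAct

variable {R H A : Type*} [CommSemiring R] [Semiring H] [AddCommMonoid A] [Module R A]

section Algebra

variable [Algebra R H] (mul : A →ₗ[R] A →ₗ[R] A) (ρ : H →ₐ[R] Module.End R A) (a b : A)

/-- The value `∑ h(a) k(b)` of a tensor `∑ h ⊗ k` on a pair `a, b`, for an action `ρ` of `H` on `A`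
and a bilinear product on `A`. -/
def tensorAct : H ⊗[R] H →ₗ[R] A :=
  TensorProduct.lift (mul.compl₁₂ (ρ.toLinearMap.flip a) (ρ.toLinearMap.flip b))

theorem tensorAct_tmul (h k : H) : tensorAct mul ρ a b (h ⊗ₜ[R] k) = mul (ρ h a) (ρ k b) := rfl

theorem tensorAct_one : tensorAct mul ρ a b 1 = mul a b := by
  rw [Algebra.TensorProduct.one_def, tensorAct_tmul, map_one, Module.End.one_apply,
    Module.End.one_apply]

theorem tensorAct_primitive (h : H) :
    tensorAct mul ρ a b (h ⊗ₜ[R] 1 + 1 ⊗ₜ[R] h) = mul (ρ h a) b + mul a (ρ h b) := by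
  rw [map_add, tensorAct_tmul, tensorAct_tmul, map_one, Module.End.one_apply, Module.End.one_apply]

theorem tensorAct_mul_tmul (u : H ⊗[R] H) (h k : H) :
    tensorAct mul ρ a b (u * (h ⊗ₜ[R] k)) = tensorAct mul ρ (ρ h a) (ρ k b) u := by
  induction u using TensorProduct.induction_on with
  | zero => rw [zero_mul, map_zero, map_zero]
  | add u v hu hv => rw [add_mul, map_add, map_add, hu, hv]
  | tmul p q =>
    rw [Algebra.TensorProduct.tmul_mul_tmul, tensorAct_tmul, tensorAct_tmul, map_mul, map_mul,
      Module.End.mul_apply, Module.End.mul_apply]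

theorem apply_tensorAct {mul : A →ₗ[R] A →ₗ[R] A} {ρ : H →ₐ[R] Module.End R A} {x : H}
    {u : H ⊗[R] H} (hx : ∀ a b, ρ x (mul a b) = tensorAct mul ρ a b u) (v : H ⊗[R] H) (a b : A) :
    ρ x (tensorAct mul ρ a b v) = tensorAct mul ρ a b (u * v) := by
  induction v using TensorProduct.induction_on with
  | zero => rw [mul_zero, map_zero, map_zero]
  | add v w hv hw => rw [mul_add, map_add, map_add, map_add, hv, hw]
  | tmul p q => rw [tensorAct_tmul, hx, tensorAct_mul_tmul]

end Algebra

theorem apply_mul_eq_tensorAct_comul_of_adjoin_eq_top [Bialgebra R H] (mul : A →ₗ[R] A →ₗ[R] A)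
    (ρ : H →ₐ[R] Module.End R A) {s : Set H} (hs : Algebra.adjoin R s = ⊤)
    (h : ∀ x ∈ s, ∀ a b, ρ x (mul a b) = tensorAct mul ρ a b (Coalgebra.comul (R := R) x))
    (x : H) (a b : A) :
    ρ x (mul a b) = tensorAct mul ρ a b (Coalgebra.comul (R := R) x) := by
  have hx : x ∈ Algebra.adjoin R s := hs ▸ Algebra.mem_top
  induction hx using Algebra.adjoin_induction generalizing a b with
  | mem x hx => exact h x hx a b
  | algebraMap r =>
    rw [AlgHom.commutes, Module.algebraMap_end_apply, Bialgebra.comul_algebraMap,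
      Algebra.algebraMap_eq_smul_one, map_smul, tensorAct_one]
  | add x y _ _ hx hy => rw [map_add, map_add, map_add, LinearMap.add_apply, hx, hy]
  | mul x y _ _ hx hy =>
    rw [map_mul, Module.End.mul_apply, hy, Bialgebra.comul_mul, apply_tensorAct hx]

end TensorAct

/-! ### The operators `X`, `Y` and `δₙ` on Hecke operators -/

section Pointwise

variable {N : ℕ} {T : GL(2, ℚ)⁺ → (ℍ → ℂ) →ₗ[ℂ] (ℍ → ℂ)}

/-- Families `T_α` of operators on `𝒬ℳ` for which `F ↦ (α ↦ T_α(F_α))` preserves `𝒬(Γ(N))`. -/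
structure IsEquivariant (N : ℕ) (T : GL(2, ℚ)⁺ → (ℍ → ℂ) →ₗ[ℂ] (ℍ → ℂ)) : Prop where
  apply_mem : ∀ α, ∀ f ∈ QM, T α f ∈ QM
  mul_left : ∀ γ ∈ GammaQ N, ∀ α, T (γ * α) = T α
  mul_right : ∀ γ ∈ GammaQ N, ∀ α, ∀ f ∈ QM, T (α * γ) (qslash γ f) = qslash γ (T α f)

/-- The operator `F ↦ (α ↦ T_α(F_α))` on `𝒬(Γ(N))`. -/
def pointwiseEnd (hT : IsEquivariant N T) : Module.End ℂ (QHecke N) where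
  toFun F :=
    ⟨fun α => T α (F.1 α), fun α => hT.apply_mem α _ (QHecke.apply_mem_QM F α),
      fun γ hγ α => by simp only [hT.mul_left γ hγ, QHecke.apply_mul_left F hγ],
      (QHecke.finite_cosets_support F).subset <| Set.image_mono fun α hα h =>
        hα <| by simp only [h, map_zero],
      fun γ hγ α => by
        simp only [QHecke.apply_mul_right F hγ, hT.mul_right γ hγ α _ (QHecke.apply_mem_QM F α)]⟩
  map_add' F G := Subtype.ext <| funext fun α => map_add (T α) _ _
  map_smul' c F := Subtype.ext <| funext fun α => map_smul (T α) c _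

theorem isEquivariant_opX (N : ℕ) : IsEquivariant N fun _ => opX where
  apply_mem _ _ := opX_mem_QM
  mul_left _ _ _ := rfl
  mul_right γ hγ _ f hf := by
    obtain ⟨δ, rfl⟩ := exists_inclSL_eq_of_mem_GammaQ hγ
    exact opX_qslash_inclSL δ hf

theorem isEquivariant_opY (N : ℕ) : IsEquivariant N fun _ => opY where
  apply_mem _ _ := opY_mem_QM
  mul_left _ _ _ := rfl
  mul_right γ _ _ _ := opY_qslash γ

theorem isEquivariant_mulLeft_muIter (N n : ℕ) :
    IsEquivariant N fun α => LinearMap.mulLeft ℂ (muIter n α) where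
  apply_mem α _ := mul_mem_QM (muIter_mem_QM α n)
  mul_left γ hγ α := by
    obtain ⟨δ, rfl⟩ := exists_inclSL_eq_of_mem_GammaQ hγ
    rw [muIter_inclSL_mul]
  mul_right γ hγ α f hf := by
    obtain ⟨δ, rfl⟩ := exists_inclSL_eq_of_mem_GammaQ hγ
    rw [muIter_mul_inclSL, LinearMap.mulLeft_apply, LinearMap.mulLeft_apply,
      qslash_mul _ (muIter_mem_QM α n) hf]

/-- The operator `X` on `𝒬(Γ(N))`. -/
def heckeX (N : ℕ) : Module.End ℂ (QHecke N) := pointwiseEnd (isEquivariant_opX N)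

/-- The operator `Y` on `𝒬(Γ(N))`. -/
def heckeY (N : ℕ) : Module.End ℂ (QHecke N) := pointwiseEnd (isEquivariant_opY N)

/-- The operator `δₙ₊₁` on `𝒬(Γ(N))`; the index is shifted by one. -/
def heckeδ (N n : ℕ) : Module.End ℂ (QHecke N) := pointwiseEnd (isEquivariant_mulLeft_muIter N n)

theorem heckeX_apply (F : QHecke N) (α : GL(2, ℚ)⁺) : (heckeX N F).1 α = opX (F.1 α) := rfl

theorem heckeY_apply (F : QHecke N) (α : GL(2, ℚ)⁺) : (heckeY N F).1 α = opY (F.1 α) := rfl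

theorem heckeδ_apply (n : ℕ) (F : QHecke N) (α : GL(2, ℚ)⁺) :
    (heckeδ N n F).1 α = muIter n α * F.1 α := rfl

theorem heckeY_heckeX : heckeY N * heckeX N - heckeX N * heckeY N = heckeX N := by
  refine LinearMap.ext fun F => Subtype.ext (funext fun α => ?_)
  change opY (opX (F.1 α)) - opX (opY (F.1 α)) = opX (F.1 α)
  rw [opY_opX (QHecke.apply_mem_QM F α), add_sub_cancel_left]

theorem heckeX_heckeδ (n : ℕ) :
    heckeX N * heckeδ N n - heckeδ N n * heckeX N = heckeδ N (n + 1) := by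
  refine LinearMap.ext fun F => Subtype.ext (funext fun α => ?_)
  change opX (muIter n α * F.1 α) - muIter n α * opX (F.1 α) = muIter (n + 1) α * F.1 α
  rw [opX_mul (muIter_mem_QM α n) (QHecke.apply_mem_QM F α), add_sub_cancel_right, muIter_succ]

theorem heckeY_heckeδ (n : ℕ) :
    heckeY N * heckeδ N n - heckeδ N n * heckeY N = ((n + 1 : ℕ) : ℂ) • heckeδ N n := by
  refine LinearMap.ext fun F => Subtype.ext (funext fun α => ?_)
  change opY (muIter n α * F.1 α) - muIter n α * opY (F.1 α)
    = ((n + 1 : ℕ) : ℂ) • (muIter n α * F.1 α)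
  rw [opY_mul (muIter_mem_QM α n) (QHecke.apply_mem_QM F α), add_sub_cancel_right, opY_muIter,
    smul_mul_assoc]

theorem heckeδ_commute (k l : ℕ) : Commute (heckeδ N k) (heckeδ N l) :=
  LinearMap.ext fun _ => Subtype.ext <| funext fun _ => mul_left_comm _ _ _

end Pointwise

/-! ### Leibniz rules for the Hecke products -/

section Leibniz

variable {N : ℕ} {H : Type*} [Group H] {ι : H →* GL(2, ℚ)⁺} {Γ : Subgroup H}

theorem opX_heckeTerm (F G : QHecke N) (α : GL(2, ℚ)⁺) (h : H) :
    opX (heckeTerm ι F.1 G.1 α h) = heckeTerm ι (heckeX N F).1 G.1 α h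
      + heckeTerm ι F.1 (heckeX N G).1 α h + heckeTerm ι (heckeδ N 0 F).1 (heckeY N G).1 α h := by
  have hG := QHecke.apply_mem_QM G (α * (ι h)⁻¹)
  simp only [heckeTerm, translate_apply, heckeX_apply, heckeY_apply, heckeδ_apply, muIter_zero]
  rw [opX_mul (QHecke.apply_mem_QM F _) (qslash_mem_QM _ hG), opX_qslash _ hG]
  ring

theorem opY_heckeTerm (F G : QHecke N) (α : GL(2, ℚ)⁺) (h : H) :
    opY (heckeTerm ι F.1 G.1 α h)
      = heckeTerm ι (heckeY N F).1 G.1 α h + heckeTerm ι F.1 (heckeY N G).1 α h := by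
  have hG := QHecke.apply_mem_QM G (α * (ι h)⁻¹)
  simp only [heckeTerm, translate_apply, heckeY_apply]
  rw [opY_mul (QHecke.apply_mem_QM F _) (qslash_mem_QM _ hG), opY_qslash _ hG]

theorem mu_mul_heckeTerm (F G : QHecke N) (α : GL(2, ℚ)⁺) (h : H) :
    mu α * heckeTerm ι F.1 G.1 α h
      = heckeTerm ι (heckeδ N 0 F).1 G.1 α h + heckeTerm ι F.1 (heckeδ N 0 G).1 α h := by
  have hμ : mu α = qslash (ι h) (mu (α * (ι h)⁻¹)) + mu (ι h) := by
    rw [← mu_mul_eq_qslash_add, inv_mul_cancel_right]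
  have hmem : mu (α * (ι h)⁻¹) ∈ QM := muIter_mem_QM _ 0
  simp only [heckeTerm, translate_apply, heckeδ_apply, muIter_zero]
  rw [qslash_mul _ hmem (QHecke.apply_mem_QM G _), hμ]
  ring

variable (hι : IsLevel N ι Γ) (F G : QHecke N)

theorem heckeX_cosetMulHom :
    heckeX N (cosetMulHom hι F G) = cosetMulHom hι (heckeX N F) G + cosetMulHom hι F (heckeX N G)
      + cosetMulHom hι (heckeδ N 0 F) (heckeY N G) := by
  have hfin (F G : QHecke N) (α : GL(2, ℚ)⁺) :=
    hasFiniteSupport_heckeTerm (QHecke.hasFiniteSupport hι F) G.1 α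
  refine Subtype.ext (funext fun α => ?_)
  rw [heckeX_apply, cosetMulHom_apply, cosetMul, map_finsum _ (hfin F G α),
    finsum_congr fun q => opX_heckeTerm F G α _,
    finsum_add_distrib ((hfin (heckeX N F) G α).fun_add (hfin F (heckeX N G) α)) (hfin _ _ α),
    finsum_add_distrib (hfin _ _ α) (hfin _ _ α)]
  rfl

theorem heckeY_cosetMulHom :
    heckeY N (cosetMulHom hι F G)
      = cosetMulHom hι (heckeY N F) G + cosetMulHom hι F (heckeY N G) := by
  have hfin (F G : QHecke N) (α : GL(2, ℚ)⁺) :=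
    hasFiniteSupport_heckeTerm (QHecke.hasFiniteSupport hι F) G.1 α
  refine Subtype.ext (funext fun α => ?_)
  rw [heckeY_apply, cosetMulHom_apply, cosetMul, map_finsum _ (hfin F G α),
    finsum_congr fun q => opY_heckeTerm F G α _, finsum_add_distrib (hfin _ _ α) (hfin _ _ α)]
  rfl

theorem heckeδ_zero_cosetMulHom :
    heckeδ N 0 (cosetMulHom hι F G)
      = cosetMulHom hι (heckeδ N 0 F) G + cosetMulHom hι F (heckeδ N 0 G) := by
  have hfin (F G : QHecke N) (α : GL(2, ℚ)⁺) :=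
    hasFiniteSupport_heckeTerm (QHecke.hasFiniteSupport hι F) G.1 α
  refine Subtype.ext (funext fun α => ?_)
  rw [heckeδ_apply, muIter_zero, cosetMulHom_apply, cosetMul, mul_finsum' _ _ (hfin F G α),
    finsum_congr fun q => mu_mul_heckeTerm F G α _, finsum_add_distrib (hfin _ _ α) (hfin _ _ α)]
  rfl

/-- The twist by `δ₁` disappears from the Leibniz rule of `∗ʳ`, since `μ` vanishes on `SL₂(ℤ)`. -/
theorem cosetMulHom_inclSL_heckeδ_zero :
    cosetMulHom (isLevel_inclSL N) (heckeδ N 0 F) G = 0 :=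
  Subtype.ext <| funext fun _ => finsum_eq_zero_of_forall_eq_zero fun q => by
    rw [heckeTerm, heckeδ_apply, muIter_zero, mu_inclSL, zero_mul, zero_mul]

theorem pointwiseEnd_heckeOne {T : GL(2, ℚ)⁺ → (ℍ → ℂ) →ₗ[ℂ] (ℍ → ℂ)} (hT : IsEquivariant N T)
    (h : ∀ γ ∈ GammaQ N, T γ 1 = 0) : pointwiseEnd hT (heckeOne N) = 0 := by
  refine Subtype.ext (funext fun α => ?_)
  change T α ((heckeOne N).1 α) = 0
  by_cases hα : α ∈ GammaQ N
  · rw [heckeOne_of_mem hα, h α hα]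
  · rw [heckeOne_of_notMem hα, map_zero]

theorem heckeX_heckeOne : heckeX N (heckeOne N) = 0 := pointwiseEnd_heckeOne _ fun _ _ => opX_one

theorem heckeY_heckeOne : heckeY N (heckeOne N) = 0 := pointwiseEnd_heckeOne _ fun _ _ => opY_one

theorem heckeδ_zero_heckeOne : heckeδ N 0 (heckeOne N) = 0 :=
  pointwiseEnd_heckeOne _ fun γ hγ => by
    obtain ⟨δ, rfl⟩ := exists_inclSL_eq_of_mem_GammaQ hγ
    rw [muIter_zero, mu_inclSL, LinearMap.mulLeft_apply, zero_mul]

end Leibniz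

/-! ### The Hopf actions -/

section HopfAction

attribute [local instance 100] LieRing.ofAssociativeRing

variable {N : ℕ}

theorem lift_genMap_hecke_eq_zero (N : ℕ) :
    ∀ r ∈ relL1, FreeLieAlgebra.lift ℂ (H1.genMap (heckeX N) (heckeY N) (heckeδ N 0)) r = 0 := by
  refine H1.genMap_rel _ _ _ (Set.range (heckeδ N)) heckeY_heckeX ?_
    (Algebra.subset_adjoin ⟨0, rfl⟩) ?_ ?_
  · rw [heckeY_heckeδ, zero_add, Nat.cast_one, one_smul]
  · rintro _ ⟨k, rfl⟩ _ ⟨l, rfl⟩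
    exact heckeδ_commute k l
  · rintro _ ⟨n, rfl⟩
    exact Algebra.subset_adjoin ⟨n + 1, (heckeX_heckeδ n).symm⟩

/-- The action of `ℋ₁` on `𝒬(Γ(N))`. -/
def actH1 (N : ℕ) : H1 →ₐ[ℂ] Module.End ℂ (QHecke N) :=
  H1.lift (heckeX N) (heckeY N) (heckeδ N 0) (lift_genMap_hecke_eq_zero N)

theorem actH1_X : actH1 N H1.X = heckeX N := H1.lift_X _ _ _ _

theorem actH1_Y : actH1 N H1.Y = heckeY N := H1.lift_Y _ _ _ _

theorem actH1_δ_one : actH1 N (H1.δ 1) = heckeδ N 0 := H1.lift_δ _ _ _ _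

theorem actH1_δ (n : ℕ+) : actH1 N (H1.δ n) = heckeδ N ((n : ℕ) - 1) := by
  induction n using PNat.recOn with
  | one => exact actH1_δ_one
  | succ n ih =>
    have hn : ((n + 1 : ℕ+) : ℕ) - 1 = ((n : ℕ) - 1) + 1 := by
      have := n.pos
      rw [PNat.add_coe, PNat.one_coe]
      omega
    rw [← H1.Xδ, map_sub, map_mul, map_mul, ih, actH1_X, heckeX_heckeδ, hn]

theorem isHopfAction_actH1 : IsHopfAction (cosetMulHom (isLevel_id N)) (actH1 N) := by
  refine apply_mul_eq_tensorAct_comul_of_adjoin_eq_top _ _ H1.adjoin_eq_top ?_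
  rintro _ (rfl | rfl | rfl) F G
  · rw [H1.comul_eq, H1.comulHom_X, map_add, tensorAct_primitive, tensorAct_tmul, actH1_X,
      actH1_Y, actH1_δ_one, heckeX_cosetMulHom]
  · rw [H1.comul_eq, H1.comulHom_Y, tensorAct_primitive, actH1_Y, heckeY_cosetMulHom]
  · rw [H1.comul_eq, H1.comulHom_δ, tensorAct_primitive, actH1_δ_one, heckeδ_zero_cosetMulHom]

theorem actH1_heckeOne (h : H1) :
    actH1 N h (heckeOne N) = Coalgebra.counit (R := ℂ) h • heckeOne N := by
  have hh : h ∈ Algebra.adjoin ℂ ({H1.X, H1.Y, H1.δ 1} : Set H1) :=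
    H1.adjoin_eq_top ▸ Algebra.mem_top
  rw [H1.counit_eq]
  induction hh using Algebra.adjoin_induction with
  | mem x hx =>
    rcases hx with rfl | rfl | rfl
    · rw [actH1_X, H1.counitHom_X, heckeX_heckeOne, zero_smul]
    · rw [actH1_Y, H1.counitHom_Y, heckeY_heckeOne, zero_smul]
    · rw [actH1_δ_one, H1.counitHom_δ, heckeδ_zero_heckeOne, zero_smul]
  | algebraMap r => rw [AlgHom.commutes, AlgHom.commutes, Module.algebraMap_end_apply]; rfl
  | add x y _ _ hx hy => rw [map_add, map_add, LinearMap.add_apply, hx, hy, add_smul]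
  | mul x y _ _ hx hy =>
    rw [map_mul, map_mul, Module.End.mul_apply, hy, map_smul, hx, smul_smul, mul_comm]

/-- The action of `𝔥₁` on `𝒬(Γ(N))`. -/
def actSmallH1 (N : ℕ) : SmallH1 →ₐ[ℂ] Module.End ℂ (QHecke N) :=
  SmallH1.lift (heckeX N) (heckeY N) heckeY_heckeX

theorem actSmallH1_X : actSmallH1 N SmallH1.X = heckeX N := SmallH1.lift_X _ _ _

theorem actSmallH1_Y : actSmallH1 N SmallH1.Y = heckeY N := SmallH1.lift_Y _ _ _

theorem isHopfAction_actSmallH1 :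
    IsHopfAction (cosetMulHom (isLevel_inclSL N)) (actSmallH1 N) := by
  refine apply_mul_eq_tensorAct_comul_of_adjoin_eq_top _ _ SmallH1.adjoin_eq_top ?_
  rintro _ (rfl | rfl) F G
  · rw [SmallH1.comul_eq, SmallH1.comulHom_X, tensorAct_primitive, actSmallH1_X,
      heckeX_cosetMulHom, cosetMulHom_inclSL_heckeδ_zero, add_zero]
  · rw [SmallH1.comul_eq, SmallH1.comulHom_Y, tensorAct_primitive, actSmallH1_Y,
      heckeY_cosetMulHom]

end HopfAction

end QMHecke

end

/-- The Hopf action of the Connes–Moscovici Hopf algebra `ℋ₁` on `(𝒬(Γ(N)), ∗)` and of `𝔥₁` on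
`(𝒬(Γ(N)), ∗ʳ)`. -/
theorem mainTheorem1 (N : ℕ) (hN : 1 ≤ N) :
    (∃ (mul : QMHecke.QHecke N →ₗ[ℂ] QMHecke.QHecke N →ₗ[ℂ] QMHecke.QHecke N)
        (one : QMHecke.QHecke N)
        (ρ : QMHecke.H1 →ₐ[ℂ] Module.End ℂ (QMHecke.QHecke N)),
      (∀ F G α, (mul F G).1 α = QMHecke.heckeMul N F.1 G.1 α) ∧
      (∀ F G K, mul (mul F G) K = mul F (mul G K)) ∧
      (∀ F, mul one F = F ∧ mul F one = F) ∧
      (∀ F α, (ρ QMHecke.H1.X F).1 α = QMHecke.opX (F.1 α)) ∧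
      (∀ F α, (ρ QMHecke.H1.Y F).1 α = QMHecke.opY (F.1 α)) ∧
      (∀ (n : ℕ+) F α, (ρ (QMHecke.H1.δ n) F).1 α =
        (QMHecke.opX ^ ((n : ℕ) - 1)) (QMHecke.mu α) * F.1 α) ∧
      QMHecke.IsHopfAction mul ρ ∧
      (∀ h, ρ h one = Coalgebra.counit (R := ℂ) h • one)) ∧
    (∃ (mulR : QMHecke.QHecke N →ₗ[ℂ] QMHecke.QHecke N →ₗ[ℂ] QMHecke.QHecke N)
        (ρ : QMHecke.SmallH1 →ₐ[ℂ] Module.End ℂ (QMHecke.QHecke N)),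
      (∀ F G α, (mulR F G).1 α = QMHecke.heckeMulR N F.1 G.1 α) ∧
      (∀ F G K, mulR (mulR F G) K = mulR F (mulR G K)) ∧
      (∀ F α, (ρ QMHecke.SmallH1.X F).1 α = QMHecke.opX (F.1 α)) ∧
      (∀ F α, (ρ QMHecke.SmallH1.Y F).1 α = QMHecke.opY (F.1 α)) ∧
      QMHecke.IsHopfAction mulR ρ) := by
  refine ⟨⟨QMHecke.cosetMulHom (QMHecke.isLevel_id N), QMHecke.heckeOne N, QMHecke.actH1 N,
    fun _ _ _ => rfl, QMHecke.cosetMulHom_assoc _,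
    fun F => ⟨QMHecke.heckeOne_mul F, QMHecke.mul_heckeOne F⟩, fun F α => ?_, fun F α => ?_,
    fun n F α => ?_, QMHecke.isHopfAction_actH1, QMHecke.actH1_heckeOne⟩,
    ⟨QMHecke.cosetMulHom (QMHecke.isLevel_inclSL N), QMHecke.actSmallH1 N,
    fun _ _ _ => rfl, QMHecke.cosetMulHom_assoc _, fun F α => ?_, fun F α => ?_,
    QMHecke.isHopfAction_actSmallH1⟩⟩
  · rw [QMHecke.actH1_X, QMHecke.heckeX_apply]
  · rw [QMHecke.actH1_Y, QMHecke.heckeY_apply]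
  · rw [QMHecke.actH1_δ, QMHecke.heckeδ_apply, QMHecke.muIter]
  · rw [QMHecke.actSmallH1_X, QMHecke.heckeX_apply]
  · rw [QMHecke.actSmallH1_Y, QMHecke.heckeY_apply]
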